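/- **Definitions.** A rooted ordered tree is a finite tree with a root and an ordering of the children of each vertex; a leaf is a non-root vertex without children. For $n,k\ge 2$ let $T_{n,k}$ be the number of rooted ordered trees with $n$ leaves, root degree one, no non-root vertex with exactly one child, and such that the path from the root to the first (leftmost) leaf has $k$ edges; put $T_{n,k}=0$ for all other $n,k\ge 0$, and let $T(x,y)=\sum_{n,k\ge 2}T_{n,k}x^ny^k$. Let $$r=3+2\sqrt2,\qquad s=\frac{\sqrt2-1}{2},\qquad q=(r^2-1)^{1/2}.$$ For $\varepsilon>0$ and $\phi\in(0,\pi/2)$ let $$\delta(\varepsilon,\phi)=\{x\in\mathbb C: |x|\le 1+\varepsilon,\ x\ne 1,\ |\mathrm{Arg}(x-1)|\ge\phi\},$$ $$\mathcal R(\varepsilon,\phi)=\{(x,y)\in\mathbb C^2: x\in\delta(\varepsilon,\phi),\ |y|<1\}.$$ All powers are principal branches, and a function is analytic on a set if it is analytic in a neighbourhood of each point of the set. Write $f(x,y)=\widetilde O\big((1-x)^{-\alpha}(1-y)^{-\beta}\big)$ if there are a domain $\mathcal R=\mathcal R(\varepsilon,\phi)$, a real $\alpha'$, and reals $\beta',\gamma\ge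 0$ such that $f$ is analytic on $\mathcal R$; $f(x,y)=O\big(|1-x|^{-\alpha'}(1-|y|)^{-\beta'}\big)$ on $\mathcal R$; and $f(x,y)=O\big(|1-x|^{-\alpha}(1-|y|)^{-\beta}\big)$ as $(1-x)(1-y)^{-\gamma}\to 0$ with $(x,y)\in\mathcal R$. Write $f(x,y)\approx c(1-x)^{-\alpha}(1-y)^{-\beta}$ if $c\neq 0$ and there are $\alpha'<\alpha$, $\beta'\ge 0$ and functions $C,C_0,C_1,E$ such that, on some domain $\mathcal R(\varepsilon,\phi)$, $$f(x,y)=C(y)(1-x)^{-\alpha}(1-y)^{-\beta}+C_0(x,y)+C_1(x,y)+E(x,y),$$ where $C$ is analytic with $C(y)=c+O(|1-y|)$ on some $\delta$-domain; $C_0$ is a polynomial in $x$ whose coefficients are analytic functions of $y$ on $|y|<1$; $C_1$ is a polynomial in $y$ whose coefficients are analytic functions of $x$ on $\delta(\varepsilon,\phi)$; and $E(x,y)=\widetilde O\big((1-x)^{-\alpha'}(1-y)^{-\beta'}\big)$. **Proposition.** (i) The power series $T\big(\tfrac{x}{r},\tfrac{y}{2s}\big)=\sum_{n,k} T_{n,k}\,(x/r)^n\,(y/(2s))^k$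 converges for $|x|<1$, $|y|<1$, its sum extends to an analytic function on some domain $\mathcal R(\varepsilon,\phi)$, and this function satisfies $$T\big(\tfrac{x}{r},\tfrac{y}{2s}\big)\approx -2qs^2(1-x)^{1/2}(1-y)^{-2}.$$ (ii) For every $p\in(0,r^{1/2})$ there is $M>0$ such that $$T_{n,k}\le M\,r^n\,n^{-3/2}\,p^{-k}\qquad\text{for all } n,k\ge 2.$$ (iii) For every $L>0$ there are $M>0$ and $k_0$ such that $$\left|T_{n,k}-\frac{qs^2}{\sqrt\pi}\,r^{n-k/2}\,n^{-3/2}\,k\right|\le M\,r^{n-k/2}\,n^{-3/2}$$ for all $n,k\ge 2$ with $k_0\le k\le L\log n$. -/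

import Mathlib

namespace DissectionTrees

/-- Rooted ordered trees: a vertex (the root) together with the ordered list of the trees
hanging from its children. -/
inductive OrderedTree : Type
  | node (children : List OrderedTree) : OrderedTree

namespace OrderedTree

/-- The list of the subtrees hanging from the children of the root. -/
def children : OrderedTree → List OrderedTree
  | node cs => cs

/-- The number of childless vertices of a tree, its top vertex included. -/
def numChildless : OrderedTree → ℕ
  | node cs => if cs = [] then 1 else (cs.map fun c => numChildless c).sum

/-- The number of leaves of a rooted ordered tree: a leaf is a *non-root* vertex without
children. -/
def numLeaves (t : OrderedTree) : ℕ :=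
  (t.children.map numChildless).sum

/-- `NoUnary t`: no vertex of `t`, the top vertex included, has exactly one child. -/
inductive NoUnary : OrderedTree → Prop
  | node (cs : List OrderedTree) (hlen : cs.length ≠ 1) (hcs : ∀ c ∈ cs, NoUnary c) :
      NoUnary (OrderedTree.node cs)

/-- The number of edges of the path that starts at the root and follows first children until it
reaches a childless vertex.  For a tree with at least one edge, this is the path from the root
to the first leaf. -/
def leftmostLength : OrderedTree → ℕ
  | node [] => 0
  | node (c :: _) => leftmostLength c + 1

end OrderedTree

/-- The rooted ordered trees with `n` leaves, root degree one, no non-root vertex with exactly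
one child, and whose path from the root to the first leaf has length `k`. -/
def treeSet (n k : ℕ) : Set OrderedTree :=
  {t | t.numLeaves = n ∧ t.children.length = 1 ∧ (∀ c ∈ t.children, c.NoUnary) ∧
    t.leftmostLength = k}

/-- `T_{n,k}`: the number of trees in `treeSet n k` for `n, k ≥ 2`, extended by zero. -/
noncomputable def treeCount (n k : ℕ) : ℕ :=
  if 2 ≤ n ∧ 2 ≤ k then (treeSet n k).ncard else 0

/-- `r = 3 + 2 √2`. -/
noncomputable def r : ℝ := 3 + 2 * √2

/-- `s = (√2 - 1) / 2`. -/
noncomputable def s : ℝ := (√2 - 1) / 2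

/-- `q = (r² - 1)^{1/2}`. -/
noncomputable def q : ℝ := √(r ^ 2 - 1)

/-- The `δ`-domain `δ(ε, φ)`. -/
def deltaDomain (ε φ : ℝ) : Set ℂ :=
  {x | ‖x‖ ≤ 1 + ε ∧ x ≠ 1 ∧ φ ≤ |Complex.arg (x - 1)|}

/-- The domain `ℛ(ε, φ)` in two variables `(x, y)`. -/
def rDomain (ε φ : ℝ) : Set (ℂ × ℂ) :=
  {z | z.1 ∈ deltaDomain ε φ ∧ ‖z.2‖ < 1}

/-- The parameters `ε`, `φ` allowed in `δ`-domains and `ℛ`-domains. -/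
def Admissible (ε φ : ℝ) : Prop :=
  0 < ε ∧ 0 < φ ∧ φ < Real.pi / 2

/-- `f(x, y) = Õ((1 - x)^{-α} (1 - y)^{-β})`, witnessed on the domain `ℛ(ε, φ)`. -/
def IsTildeOOn (ε φ : ℝ) (f : ℂ × ℂ → ℂ) (α β : ℝ) : Prop :=
  AnalyticOnNhd ℂ f (rDomain ε φ) ∧
  ∃ α' β' γ : ℝ, 0 ≤ β' ∧ 0 ≤ γ ∧
    (∃ K : ℝ, ∀ x y : ℂ, (x, y) ∈ rDomain ε φ →
      ‖f (x, y)‖ ≤ K * (‖1 - x‖ ^ (-α') * (1 - ‖y‖) ^ (-β'))) ∧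
    (∃ K η : ℝ, 0 < η ∧ ∀ x y : ℂ, (x, y) ∈ rDomain ε φ →
      ‖1 - x‖ * ‖1 - y‖ ^ (-γ) < η →
      ‖f (x, y)‖ ≤ K * (‖1 - x‖ ^ (-α) * (1 - ‖y‖) ^ (-β)))

/-- `f(x, y) ≈ c (1 - x)^{-α} (1 - y)^{-β}`, with principal branches.  The function
`C₀(x, y) = ∑ i < d₀, a i y * x ^ i` is a polynomial in `x` and
`C₁(x, y) = ∑ i < d₁, b i x * y ^ i` is a polynomial in `y`, each with coefficients that are
analytic in the other variable.  One domain `ℛ(ε, φ)` serves both for the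
identity and for the error term: since the intersection of two `ℛ`-domains contains an
`ℛ`-domain, this is no restriction. -/
def IsApprox (f : ℂ × ℂ → ℂ) (c : ℂ) (α β : ℝ) : Prop :=
  c ≠ 0 ∧
  ∃ (α' β' : ℝ) (C : ℂ → ℂ) (d₀ d₁ : ℕ) (a b : ℕ → ℂ → ℂ) (E : ℂ × ℂ → ℂ) (ε φ : ℝ),
    α' < α ∧ 0 ≤ β' ∧ Admissible ε φ ∧
    (∀ x y : ℂ, (x, y) ∈ rDomain ε φ →
      f (x, y) = C y * (1 - x) ^ (-(α : ℂ)) * (1 - y) ^ (-(β : ℂ))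
        + (∑ i ∈ Finset.range d₀, a i y * x ^ i) + (∑ i ∈ Finset.range d₁, b i x * y ^ i)
        + E (x, y)) ∧
    (∃ ε₁ φ₁ : ℝ, Admissible ε₁ φ₁ ∧ AnalyticOnNhd ℂ C (deltaDomain ε₁ φ₁) ∧
      ∃ K : ℝ, ∀ y ∈ deltaDomain ε₁ φ₁, ‖C y - c‖ ≤ K * ‖1 - y‖) ∧
    (∀ i, AnalyticOnNhd ℂ (a i) {y | ‖y‖ < 1}) ∧
    (∀ i, AnalyticOnNhd ℂ (b i) (deltaDomain ε φ)) ∧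
    IsTildeOOn ε φ E α' β'

/-- `f` is the analytic function on an `ℛ`-domain with which the double power series
`∑ A n k * x ^ n * y ^ k` is identified: it is analytic there and it is the sum of the series on
the unit bidisc, which is contained in every `ℛ`-domain. -/
def IsAnalyticSum (A : ℕ → ℕ → ℂ) (f : ℂ × ℂ → ℂ) : Prop :=
  (∃ ε φ : ℝ, Admissible ε φ ∧ AnalyticOnNhd ℂ f (rDomain ε φ)) ∧
  ∀ x y : ℂ, ‖x‖ < 1 → ‖y‖ < 1 →
    HasSum (fun i : ℕ × ℕ => A i.1 i.2 * x ^ i.1 * y ^ i.2) (f (x, y))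

/-- The coefficients of the rescaled generating function `T(x/r, y/2s)`, that is, of
`∑ T_{n,k} (x/r)^n (y/(2s))^k`. -/
noncomputable def scaledCoeff (n k : ℕ) : ℂ :=
  (treeCount n k : ℂ) / ((r : ℂ) ^ n * (2 * (s : ℂ)) ^ k)

end DissectionTrees

/-!
Let `W` be the generating function, by childless vertices, of the nonempty ordered forests without
unary vertices.  A tree whose leftmost path has `j` edges is a leaf together with a nonempty forest
of right siblings at each of these edges, so the number of trees with `n` leaves and leftmost path
of length `k` is the coefficient of `z ^ (n - 1)` in `W ^ (k - 1)` (`treeCount_eq_coeff`), and the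
decomposition of trees and forests at their first subtree gives `W = z + z W + W ^ 2`
(`forestSeries_quadratic`).  With `V(x) = W(x / r) / (2 s)` this equation has the explicit solution
`V(x) = (1 - x / r - √(1 - x) √(1 - x / r ^ 2)) / (4 s)` (`forestSeries_eq_rescale`), and
`T(x / r, y / (2 s)) = 2 s x y * y V(x) / (1 - y V(x))`.

*The singular expansion.*  `V` is analytic off the ray `[1, ∞)`.  The function `1 / (1 - y V(x))`
is analytic as long as `|V(x)| ≤ 1`.  On the closed unit disc the algebraic equation allows
`|V(x)| = 1` only at `x = 1`, and a segment to `0` then shows `|V| < 1` elsewhere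
(`norm_normFun_lt_one`).  Near `1` the bound persists in a sector, because `1 - V(x)` is
`√(1 - x)` times a positive constant up to `O(|1 - x|)`; compactness extends it to a delta-domain
(`exists_norm_normFun_lt_one`).  With `u = 1 - V(x)`, the identity
`1 / (1 - y V) = 1 / (1 - y) - y u / (1 - y) ^ 2 + y ^ 2 u ^ 2 / ((1 - y) ^ 2 (1 - y V))` exhibits
the three terms of the expansion: a polynomial in `x`, the main term, and an error
`O(|1 - x| (1 - |y|) ^ (-3))` (`errorFun_eq`, `norm_errorFun_le`).

*The coefficients.*  These estimates use no contour integral.  The coefficients of `V` are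
nonnegative with sum at most `1`, hence multiplication by powers of `V` preserves bounds on
coefficients (`abs_coeff_mul_normSeries_pow_le`).  The second derivative of `V ^ j - 1 - j (V - 1)`
is a sum of `O(j ^ 2)` terms, each of which is `V' ^ 2` or `V'' (1 - V)` times a power of `V`.
Both `V' ^ 2` and `V'' (1 - V)` have bounded coefficients, as they have order `(1 - x) ^ (-1)` at
the singularity.  Therefore the coefficient of `x ^ m` in `V ^ j` is `j` times that in `V`, up to
`O(j ^ 2 / m ^ 2)`, uniformly in `j` (`coeff_normSeries_pow_sub`).  The coefficients of `V` are in
turn compared with those of `√(1 - x)`, again by two bounded derivatives, and the latter are given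
by the Wallis product, which yields `m ^ (-3/2)` up to `O(m ^ (-2))` (`coeff_normSeries_asymp`).
-/

namespace DissectionTrees

open PowerSeries
open Finset.HasAntidiagonal (antidiagonal)

/-! ### Tree and forest generating functions -/

/-- If the objects `f a b` are determined by their components `a ∈ A` and `b ∈ B`, and their weight
is the sum of the weights of the components, then the number of objects of weight `n` is the
convolution of the numbers of components of given weights. -/
lemma ncard_weight_convolution {α β γ : Type*} (A : ℕ → Set α) (B : ℕ → Set β) (f : α → β → γ)
    (hf : Function.Injective2 f) (hA : ∀ n, (A n).Finite) (hB : ∀ n, (B n).Finite)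
    (dA : ∀ m n a, a ∈ A m → a ∈ A n → m = n) (dB : ∀ m n b, b ∈ B m → b ∈ B n → m = n) (n : ℕ) :
    {c | ∃ i j, i + j = n ∧ ∃ a ∈ A i, ∃ b ∈ B j, f a b = c}.Finite ∧
    {c | ∃ i j, i + j = n ∧ ∃ a ∈ A i, ∃ b ∈ B j, f a b = c}.ncard =
      ∑ p ∈ antidiagonal n, (A p.1).ncard * (B p.2).ncard := by
  classical
  have key : {c | ∃ i j, i + j = n ∧ ∃ a ∈ A i, ∃ b ∈ B j, f a b = c} =
      (((antidiagonal n).biUnion fun p =>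
        Finset.image₂ f (hA p.1).toFinset (hB p.2).toFinset : Finset γ) : Set γ) := by
    ext c
    simp only [Set.mem_ofPred_eq, Finset.coe_biUnion, Finset.mem_coe,
      Finset.HasAntidiagonal.mem_antidiagonal, Finset.coe_image₂, Set.Finite.coe_toFinset,
      Set.mem_iUnion, Set.mem_image2, Prod.exists, exists_prop]
  rw [key]
  refine ⟨Finset.finite_toSet _, ?_⟩
  rw [Set.ncard_coe_finset, Finset.card_biUnion]
  · refine Finset.sum_congr rfl fun p _ => ?_
    rw [Finset.card_image₂ hf, ← Set.ncard_eq_toFinset_card _ (hA _),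
      ← Set.ncard_eq_toFinset_card _ (hB _)]
  · intro p _ p' _ hne
    rw [Function.onFun, Finset.disjoint_left]
    intro c hc hc'
    simp only [Finset.mem_image₂, Set.Finite.mem_toFinset] at hc hc'
    obtain ⟨a, ha, b, hb, rfl⟩ := hc
    obtain ⟨a', ha', b', hb', he⟩ := hc'
    obtain ⟨rfl, rfl⟩ := hf he
    exact hne (Prod.ext (dA _ _ _ ha ha') (dB _ _ _ hb hb'))

/-- The trees without unary vertices that have `n` childless vertices. -/
def planeTrees (n : ℕ) : Set OrderedTree := {t | t.NoUnary ∧ t.numChildless = n}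

/-- The nonempty lists of trees without unary vertices that have `n` childless vertices in total. -/
def forests (n : ℕ) : Set (List OrderedTree) :=
  {l | l ≠ [] ∧ (∀ c ∈ l, c.NoUnary) ∧ (l.map OrderedTree.numChildless).sum = n}

/-- The trees in `planeTrees n` whose leftmost path has `j` edges. -/
def leftmostTrees (j n : ℕ) : Set OrderedTree :=
  {t | t.NoUnary ∧ t.numChildless = n ∧ t.leftmostLength = j}

/-- The tree with first subtree `t` whose remaining subtrees are those of `l`. -/
def graft (t : OrderedTree) (l : List OrderedTree) : OrderedTree := .node (t :: l)

lemma graft_injective2 : Function.Injective2 graft := by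
  intro a a' b b' h
  simpa [graft] using h

lemma numChildless_node_cons (t : OrderedTree) (l : List OrderedTree) :
    (OrderedTree.node (t :: l)).numChildless =
      t.numChildless + (l.map OrderedTree.numChildless).sum := by
  simp [OrderedTree.numChildless]

lemma numChildless_leaf : (OrderedTree.node []).numChildless = 1 := by
  simp [OrderedTree.numChildless]

lemma noUnary_node_iff (l : List OrderedTree) :
    (OrderedTree.node l).NoUnary ↔ l.length ≠ 1 ∧ ∀ c ∈ l, c.NoUnary :=
  ⟨fun h => by cases h with | node _ h1 h2 => exact ⟨h1, h2⟩, fun h => .node _ h.1 h.2⟩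

lemma noUnary_node_cons_iff (t : OrderedTree) (l : List OrderedTree) :
    (OrderedTree.node (t :: l)).NoUnary ↔ t.NoUnary ∧ l ≠ [] ∧ ∀ c ∈ l, c.NoUnary := by
  rw [noUnary_node_iff]
  simp only [List.length_cons, List.mem_cons, forall_eq_or_imp]
  have : l.length + 1 ≠ 1 ↔ l ≠ [] := by
    rw [← List.length_pos_iff]; omega
  tauto

lemma numChildless_pos {t : OrderedTree} (h : t.NoUnary) : 0 < t.numChildless := by
  induction h with
  | node cs _ _ ih =>
    cases cs with
    | nil => simp [numChildless_leaf]
    | cons c l =>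
      rw [numChildless_node_cons]
      exact Nat.add_pos_left (ih c (by simp)) _

lemma planeTrees_zero : planeTrees 0 = ∅ := by
  ext t
  simp only [planeTrees, Set.mem_ofPred_eq, Set.mem_empty_iff_false, iff_false, not_and]
  exact fun h => (numChildless_pos h).ne'

lemma forests_zero : forests 0 = ∅ := by
  ext l
  simp only [forests, Set.mem_ofPred_eq, Set.mem_empty_iff_false, iff_false]
  rintro ⟨h0, h1, h2⟩
  cases l with
  | nil => exact h0 rfl
  | cons c l =>
    have := numChildless_pos (h1 c (by simp))
    simp at h2
    omega

lemma planeTrees_eq (n : ℕ) : planeTrees n = (if n = 1 then {OrderedTree.node []} else ∅) ∪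
    {c | ∃ i j, i + j = n ∧ ∃ a ∈ planeTrees i, ∃ b ∈ forests j, graft a b = c} := by
  ext t
  obtain ⟨_ | ⟨c, l⟩⟩ := t
  · simp only [planeTrees, Set.mem_ofPred_eq, noUnary_node_iff, numChildless_leaf, Set.mem_union,
      graft]
    by_cases hn : n = 1
    · simp [hn]
    · simp [hn, Ne.symm hn]
  · simp only [planeTrees, forests, Set.mem_ofPred_eq, noUnary_node_cons_iff,
      numChildless_node_cons, Set.mem_union, graft]
    have : OrderedTree.node (c :: l) ∉
        (if n = 1 then {OrderedTree.node []} else ∅ : Set OrderedTree) := by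
      split_ifs <;> simp
    simp only [this, false_or, OrderedTree.node.injEq, List.cons.injEq]
    constructor
    · rintro ⟨⟨h1, h2, h3⟩, h4⟩
      exact ⟨_, _, h4, c, ⟨h1, rfl⟩, l, ⟨h2, h3, rfl⟩, rfl, rfl⟩
    · rintro ⟨i, j, hij, a, ⟨ha, rfl⟩, b, ⟨hb, hb', rfl⟩, rfl, rfl⟩
      exact ⟨⟨ha, hb, hb'⟩, hij⟩

lemma forests_eq (n : ℕ) : forests n = (fun t => [t]) '' planeTrees n ∪
    {c | ∃ i j, i + j = n ∧ ∃ a ∈ planeTrees i, ∃ b ∈ forests j, a :: b = c} := by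
  ext l
  obtain _ | ⟨c, _ | ⟨d, l⟩⟩ := l
  · simp [forests]
  · simp [forests, planeTrees]
  · simp only [planeTrees, forests, Set.mem_ofPred_eq, Set.mem_union, Set.mem_image]
    constructor
    · rintro ⟨-, h1, h2⟩
      exact Or.inr ⟨c.numChildless, ((d :: l).map OrderedTree.numChildless).sum, by simpa using h2,
        c, ⟨h1 c (by simp), rfl⟩, d :: l, ⟨by simp, fun x hx => h1 x (by simp_all), rfl⟩, rfl⟩
    · rintro (⟨t, -, ht⟩ | ⟨i, j, hij, a, ⟨ha, rfl⟩, b, ⟨-, hb', rfl⟩, he⟩)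
      · simp at ht
      · obtain ⟨rfl, rfl⟩ := List.cons.inj he
        refine ⟨by simp, ?_, by simpa using hij⟩
        intro x hx
        rcases List.mem_cons.1 hx with rfl | hx
        exacts [ha, hb' x hx]

lemma leftmostTrees_zero (n : ℕ) :
    leftmostTrees 0 n = if n = 1 then {OrderedTree.node []} else ∅ := by
  ext t
  obtain ⟨_ | ⟨c, l⟩⟩ := t
  · simp only [leftmostTrees, Set.mem_ofPred_eq, noUnary_node_iff, numChildless_leaf,
      OrderedTree.leftmostLength]
    by_cases hn : n = 1
    · simp [hn]
    · simp [hn, Ne.symm hn]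
  · simp only [leftmostTrees, Set.mem_ofPred_eq, OrderedTree.leftmostLength]
    split_ifs <;> simp

lemma leftmostTrees_succ (j n : ℕ) : leftmostTrees (j + 1) n =
    {c | ∃ i l, i + l = n ∧ ∃ a ∈ leftmostTrees j i, ∃ b ∈ forests l, graft a b = c} := by
  ext t
  obtain ⟨_ | ⟨c, l⟩⟩ := t
  · simp [leftmostTrees, OrderedTree.leftmostLength, graft]
  · simp only [leftmostTrees, forests, Set.mem_ofPred_eq, noUnary_node_cons_iff,
      numChildless_node_cons, graft, OrderedTree.leftmostLength, OrderedTree.node.injEq,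
      List.cons.injEq, Nat.add_right_cancel_iff]
    constructor
    · rintro ⟨⟨h1, h2, h3⟩, h4, h5⟩
      exact ⟨_, _, h4, c, ⟨h1, rfl, h5⟩, l, ⟨h2, h3, rfl⟩, rfl, rfl⟩
    · rintro ⟨i, j, hij, a, ⟨ha, rfl, hj⟩, b, ⟨hb, hb', rfl⟩, rfl, rfl⟩
      exact ⟨⟨ha, hb, hb'⟩, hij, hj⟩

/-- There are finitely many trees, and finitely many forests, with a given number of childless
vertices: in the decompositions `planeTrees_eq` and `forests_eq` both components are smaller. -/
lemma finite_planeTrees_forests (n : ℕ) : (planeTrees n).Finite ∧ (forests n).Finite := by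
  induction n using Nat.strong_induction_on with
  | _ n ih =>
    have key : ∀ {γ : Type} (f : OrderedTree → List OrderedTree → γ),
        {c | ∃ i j, i + j = n ∧ ∃ a ∈ planeTrees i, ∃ b ∈ forests j, f a b = c}.Finite := by
      intro γ f
      refine ((Set.finite_Iio n).biUnion fun i hi => (Set.finite_Iio n).biUnion fun j hj =>
        ((ih i hi).1.image2 f (ih j hj).2)).subset ?_
      rintro c ⟨i, j, hij, a, ha, b, hb, rfl⟩
      have hi : i ≠ 0 := by rintro rfl; simp [planeTrees_zero] at ha
      have hj : j ≠ 0 := by rintro rfl; simp [forests_zero] at hb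
      simp only [Set.mem_iUnion]
      exact ⟨i, by simp; omega, j, by simp; omega, a, ha, b, hb, rfl⟩
    have h1 : (planeTrees n).Finite := by
      rw [planeTrees_eq]
      refine Set.Finite.union ?_ (key _)
      split_ifs <;> simp
    refine ⟨h1, ?_⟩
    rw [forests_eq]
    exact (h1.image _).union (key _)

lemma finite_leftmostTrees (j n : ℕ) : (leftmostTrees j n).Finite :=
  (finite_planeTrees_forests n).1.subset fun _ h => ⟨h.1, h.2.1⟩

/-- The generating function of the trees without unary vertices, by childless vertices. -/
noncomputable def treeSeries : ℝ⟦X⟧ := mk fun n => ((planeTrees n).ncard : ℝ)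

/-- The generating function of the nonempty forests without unary vertices, by childless
vertices. -/
noncomputable def forestSeries : ℝ⟦X⟧ := mk fun n => ((forests n).ncard : ℝ)

lemma ncard_planeTrees (n : ℕ) : (planeTrees n).ncard = (if n = 1 then 1 else 0) +
    ∑ p ∈ antidiagonal n, (planeTrees p.1).ncard * (forests p.2).ncard := by
  obtain ⟨hfin, hcard⟩ := ncard_weight_convolution planeTrees forests graft graft_injective2
    (fun n => (finite_planeTrees_forests n).1) (fun n => (finite_planeTrees_forests n).2)
    (fun m n a h h' => h.2.symm.trans h'.2) (fun m n b h h' => h.2.2.symm.trans h'.2.2) n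
  rw [planeTrees_eq n, Set.ncard_union_eq _ (by split_ifs <;> simp) hfin, hcard]
  · congr 1
    split_ifs <;> simp
  · rw [Set.disjoint_left]
    rintro t ht ⟨i, j, -, a, -, b, -, rfl⟩
    split_ifs at ht <;> simp [graft] at ht

lemma ncard_forests (n : ℕ) : (forests n).ncard = (planeTrees n).ncard +
    ∑ p ∈ antidiagonal n, (planeTrees p.1).ncard * (forests p.2).ncard := by
  obtain ⟨hfin, hcard⟩ := ncard_weight_convolution planeTrees forests List.cons
    (fun a a' b b' h => by simpa using h)
    (fun n => (finite_planeTrees_forests n).1) (fun n => (finite_planeTrees_forests n).2)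
    (fun m n a h h' => h.2.symm.trans h'.2) (fun m n b h h' => h.2.2.symm.trans h'.2.2) n
  rw [forests_eq n, Set.ncard_union_eq _ ((finite_planeTrees_forests n).1.image _) hfin, hcard,
    Set.ncard_image_of_injective _ fun a b h => by simpa using h]
  rw [Set.disjoint_left]
  rintro l ⟨t, -, rfl⟩ ⟨i, j, -, a, -, b, hb, he⟩
  exact hb.1 (List.cons.inj he).2

lemma ncard_leftmostTrees_succ (j n : ℕ) : (leftmostTrees (j + 1) n).ncard =
    ∑ p ∈ antidiagonal n, (leftmostTrees j p.1).ncard * (forests p.2).ncard := by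
  rw [leftmostTrees_succ]
  exact (ncard_weight_convolution (leftmostTrees j) forests graft graft_injective2
    (fun n => finite_leftmostTrees j n) (fun n => (finite_planeTrees_forests n).2)
    (fun m n a h h' => h.2.1.symm.trans h'.2.1) (fun m n b h h' => h.2.2.symm.trans h'.2.2) n).2

lemma treeSeries_eq : treeSeries = X + treeSeries * forestSeries := by
  ext n
  rw [map_add, coeff_mul, coeff_X]
  simp only [treeSeries, forestSeries, coeff_mk]
  rw [ncard_planeTrees]
  push_cast
  norm_num

lemma forestSeries_eq : forestSeries = treeSeries + treeSeries * forestSeries := by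
  ext n
  rw [map_add, coeff_mul]
  simp only [treeSeries, forestSeries, coeff_mk]
  rw [ncard_forests]
  push_cast
  norm_num

/-- The algebraic equation of the large Schröder numbers. -/
lemma forestSeries_quadratic :
    forestSeries = X + X * forestSeries + forestSeries ^ 2 := by
  linear_combination (1 - forestSeries) * forestSeries_eq + (1 + forestSeries) * treeSeries_eq

/-- The trees with leftmost path of length `j` are obtained from a single leaf by adding a forest
of right siblings at each of the `j` edges. -/
lemma coeff_X_mul_forestSeries_pow (j n : ℕ) :
    coeff n (X * forestSeries ^ j) = ((leftmostTrees j n).ncard : ℝ) := by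
  induction j generalizing n with
  | zero =>
    rw [pow_zero, mul_one, coeff_X, leftmostTrees_zero]
    split_ifs <;> simp
  | succ j ih =>
    rw [pow_succ, ← mul_assoc, coeff_mul, ncard_leftmostTrees_succ]
    push_cast
    exact Finset.sum_congr rfl fun p _ => by rw [ih, forestSeries, coeff_mk]

lemma ncard_treeSet (n k : ℕ) : (treeSet n (k + 1)).ncard = (leftmostTrees k n).ncard := by
  have : treeSet n (k + 1) = (fun t => OrderedTree.node [t]) '' leftmostTrees k n := by
    ext t
    obtain ⟨_ | ⟨c, _ | ⟨d, l⟩⟩⟩ := t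
    · simp [treeSet, OrderedTree.children]
    · simp [treeSet, leftmostTrees, OrderedTree.children, OrderedTree.numLeaves,
        OrderedTree.leftmostLength]
      tauto
    · simp [treeSet, OrderedTree.children]
  rw [this, Set.ncard_image_of_injective]
  intro a b h
  simpa using h

lemma treeCount_eq_coeff (m j : ℕ) :
    (treeCount (m + 2) (j + 2) : ℝ) = coeff (m + 1) (forestSeries ^ (j + 1)) := by
  rw [treeCount, if_pos (by omega), ncard_treeSet, ← coeff_X_mul_forestSeries_pow,
    coeff_succ_X_mul]

lemma forestSeries_constantCoeff : coeff 0 forestSeries = 0 := by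
  simp [forestSeries, forests_zero]

/-! ### The constants -/

lemma s_pos : 0 < s := by
  have : (1 : ℝ) < √2 := Real.lt_sqrt_of_sq_lt (by norm_num)
  unfold s; linarith

lemma r_mul_sq_s : r * (4 * s ^ 2) = 1 := by
  have := Real.sq_sqrt (show (0 : ℝ) ≤ 2 by norm_num)
  unfold r s
  linear_combination (2 * √2 - 1) * this

lemma r_pos : 0 < r := by unfold r; positivity

lemma r_ne_zero : r ≠ 0 := r_pos.ne'

lemma r_inv : r⁻¹ = 4 * s ^ 2 := by
  rw [inv_eq_of_mul_eq_one_right r_mul_sq_s]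

lemma four_s : 4 * s = 1 - r⁻¹ := by
  have := Real.sq_sqrt (show (0 : ℝ) ≤ 2 by norm_num)
  rw [r_inv]
  unfold s
  linear_combination this

lemma r_add_inv : r + r⁻¹ = 6 := by
  have := Real.sq_sqrt (show (0 : ℝ) ≤ 2 by norm_num)
  rw [r_inv]
  unfold r s
  linear_combination this

lemma r_inv_pos : 0 < r⁻¹ := inv_pos.2 r_pos

lemma r_inv_lt_one : r⁻¹ < 1 := by
  have := four_s; have := s_pos; linarith

lemma one_lt_r : 1 < r := by
  have := r_add_inv; have := r_inv_lt_one; linarith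

lemma r_inv_sq_lt_one : r⁻¹ ^ 2 < 1 := by
  have := r_inv_pos; have := r_inv_lt_one; nlinarith

lemma q_div_r : √(1 - r⁻¹ ^ 2) = q / r := by
  rw [q, ← Real.sqrt_sq r_pos.le, ← Real.sqrt_div' _ (sq_nonneg _), Real.sqrt_sq r_pos.le]
  congr 1
  field_simp [r_ne_zero]

lemma q_pos : 0 < q := by
  refine Real.sqrt_pos.2 ?_
  have := one_lt_r; nlinarith

lemma sqrt_r : √r = (2 * s)⁻¹ := by
  rw [Real.sqrt_eq_iff_mul_self_eq_of_pos (by have := s_pos; positivity)]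
  have := r_mul_sq_s
  have := s_pos.ne'
  field_simp
  linarith

/-! ### The explicit solution of the Schröder equation -/

lemma rescale_C (a b : ℝ) : rescale a (C b) = C b := by
  ext n
  rw [coeff_rescale, coeff_C]
  split_ifs with h <;> simp [h]

/-- The power series of `√(1 - x)`. -/
noncomputable def sqrtSeries : ℝ⟦X⟧ := rescale (-1) (PowerSeries.binomialSeries ℝ (1 / 2 : ℝ))

lemma coeff_sqrtSeries (n : ℕ) : coeff n sqrtSeries = (-1) ^ n * Ring.choose (1 / 2 : ℝ) n := by
  simp [sqrtSeries, coeff_rescale]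

lemma sqrtSeries_sq : sqrtSeries ^ 2 = 1 - X := by
  have h : (PowerSeries.binomialSeries ℝ (1 / 2 : ℝ)) ^ 2 = 1 + X := by
    rw [sq, ← binomialSeries_add, show (1 / 2 + 1 / 2 : ℝ) = ((1 : ℕ) : ℝ) by norm_num,
      binomialSeries_nat, pow_one]
  rw [sqrtSeries, ← map_pow, h, map_add, map_one, rescale_X]
  simp [sub_eq_add_neg]

lemma coeff_zero_sqrtSeries : coeff 0 sqrtSeries = 1 := by
  simp [coeff_sqrtSeries]

/-- The differential equation of `√(1 - x)`. -/
lemma derivative_sqrtSeries : 2 * (1 - X) * d⁄dX ℝ sqrtSeries = -sqrtSeries := by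
  have h := congrArg (d⁄dX ℝ) sqrtSeries_sq
  rw [derivative_pow, map_sub, derivative_one, derivative_X] at h
  rw [← sqrtSeries_sq]
  have h2 : 2 * sqrtSeries * d⁄dX ℝ sqrtSeries = -1 := by
    simpa using h
  linear_combination sqrtSeries * h2

/-- The power series of `√(1 - x / r ^ 2)`. -/
noncomputable def sqrtSeries' : ℝ⟦X⟧ := rescale (r⁻¹ ^ 2) sqrtSeries

lemma coeff_sqrtSeries' (n : ℕ) : coeff n sqrtSeries' = (r⁻¹ ^ 2) ^ n * coeff n sqrtSeries := by
  simp [sqrtSeries', coeff_rescale]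

lemma sqrtSeries'_sq : sqrtSeries' ^ 2 = 1 - C (r⁻¹ ^ 2) * X := by
  rw [sqrtSeries', ← map_pow, sqrtSeries_sq, map_sub, map_one, rescale_X]

/-- The power series of `√((1 - x) (1 - x / r ^ 2))`. -/
noncomputable def discSeries : ℝ⟦X⟧ := sqrtSeries * sqrtSeries'

lemma discSeries_sq : discSeries ^ 2 = (1 - X) * (1 - C (r⁻¹ ^ 2) * X) := by
  rw [discSeries, mul_pow, sqrtSeries_sq, sqrtSeries'_sq]

/-- The generating function of forests, rescaled so that its singularity of smallest modulus is
`1` and its value there is `1`. -/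
noncomputable def normSeries : ℝ⟦X⟧ := C (4 * s)⁻¹ * (1 - C r⁻¹ * X - discSeries)

lemma coeff_zero_normSeries : coeff 0 normSeries = 0 := by
  have h1 := coeff_zero_sqrtSeries
  have h2 := coeff_sqrtSeries' 0
  rw [coeff_zero_sqrtSeries] at h2
  rw [coeff_zero_eq_constantCoeff_apply] at h1 h2 ⊢
  simp [normSeries, discSeries, h1, h2]

/-- A power series without constant term is determined by the equation of the Schröder numbers. -/
lemma quadratic_unique {w w' : ℝ⟦X⟧} (h : w = X + X * w + w ^ 2) (h' : w' = X + X * w' + w' ^ 2)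
    (h0 : constantCoeff w = 0) (h0' : constantCoeff w' = 0) : w = w' := by
  have h1 : (w - w') * (1 - X - w - w') = 0 := by linear_combination h - h'
  rcases mul_eq_zero.1 h1 with h2 | h2
  · exact sub_eq_zero.1 h2
  · have := congrArg constantCoeff h2
    simp [h0, h0'] at this

/-- The explicit solution of `forestSeries_quadratic`, in rescaled form. -/
lemma forestSeries_eq_rescale : forestSeries = C (2 * s) * rescale r normSeries := by
  have hs := s_pos.ne'
  have hr := r_ne_zero
  have hsq : (rescale r discSeries) ^ 2 = 1 - C 6 * X + X ^ 2 := by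
    rw [← map_pow, discSeries_sq]
    simp only [map_mul, map_sub, map_one, rescale_X, rescale_C]
    rw [← r_add_inv, map_add]
    have h1 : (C r : ℝ⟦X⟧) * C r⁻¹ = 1 := by rw [← map_mul, mul_inv_cancel₀ hr, map_one]
    rw [map_pow]
    linear_combination (-X * C r⁻¹ + C r * C r⁻¹ * X ^ 2 + X ^ 2) * h1
  have h2 : (2 : ℝ⟦X⟧) * (C (2 * s) * rescale r normSeries) = 1 - X - rescale r discSeries := by
    rw [normSeries]
    simp only [map_mul, map_sub, map_one, rescale_X, rescale_C]
    have h3 : (2 : ℝ⟦X⟧) * (C 2 * C s) * C (4 * s)⁻¹ = 1 := by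
      rw [← map_ofNat (C (R := ℝ)) 2, ← map_mul, ← map_mul, ← map_mul, ← map_one C]
      congr 1
      field_simp
      norm_num
    have h1 : (C r⁻¹ : ℝ⟦X⟧) * C r = 1 := by rw [← map_mul, inv_mul_cancel₀ hr, map_one]
    linear_combination (1 - C r⁻¹ * (C r * X) - rescale r discSeries) * h3 - X * h1
  refine quadratic_unique forestSeries_quadratic ?_ ?_ ?_
  · set w := C (2 * s) * rescale r normSeries
    have h6 : (C 6 : ℝ⟦X⟧) = 6 := map_ofNat C 6
    rw [h6] at hsq
    have h4 : (4 : ℝ⟦X⟧) * (w - (X + X * w + w ^ 2)) = 0 := by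
      linear_combination (2 - 2 * X - 2 * w - (1 - X - rescale r discSeries)) * h2 - hsq
    have : (4 : ℝ⟦X⟧) ≠ 0 := by
      rw [← map_ofNat (C (R := ℝ)) 4, ne_eq, map_eq_zero_iff C C_injective]
      norm_num
    exact sub_eq_zero.1 ((mul_eq_zero.1 h4).resolve_left this)
  · rw [← coeff_zero_eq_constantCoeff_apply, forestSeries_constantCoeff]
  · rw [map_mul, ← coeff_zero_eq_constantCoeff_apply (rescale r normSeries), coeff_rescale,
      coeff_zero_normSeries]
    simp

lemma coeff_forestSeries_pow (m j : ℕ) :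
    coeff m (forestSeries ^ j) = r ^ m * (2 * s) ^ j * coeff m (normSeries ^ j) := by
  rw [forestSeries_eq_rescale, mul_pow, ← map_pow, ← map_pow, coeff_C_mul, coeff_rescale]
  ring

/-- The coefficients count trees, up to a positive factor. -/
lemma coeff_normSeries_pow_nonneg (m j : ℕ) : 0 ≤ coeff m (normSeries ^ j) := by
  have h := coeff_forestSeries_pow m j
  have h0 : 0 ≤ coeff (m + 1) (X * forestSeries ^ j) := by
    rw [coeff_X_mul_forestSeries_pow]; positivity
  rw [coeff_succ_X_mul, h] at h0
  have := r_pos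
  have := s_pos
  exact nonneg_of_mul_nonneg_right h0 (by positivity)

lemma treeCount_eq (m j : ℕ) : (treeCount (m + 2) (j + 2) : ℝ) =
    r ^ (m + 1) * (2 * s) ^ (j + 1) * coeff (m + 1) (normSeries ^ (j + 1)) := by
  rw [treeCount_eq_coeff, coeff_forestSeries_pow]

/-! ### Absolutely convergent evaluation of real power series at complex points -/

/-- The series `p` converges absolutely at `x`, with sum `a`. -/
def AbsHasSum (p : ℝ⟦X⟧) (x a : ℂ) : Prop :=
  Summable (fun n => ‖((coeff n p : ℝ) : ℂ) * x ^ n‖) ∧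
    HasSum (fun n => ((coeff n p : ℝ) : ℂ) * x ^ n) a

namespace AbsHasSum

variable {p p' : ℝ⟦X⟧} {x a a' : ℂ}

lemma sub (h : AbsHasSum p x a) (h' : AbsHasSum p' x a') : AbsHasSum (p - p') x (a - a') := by
  have he : ∀ n, ((coeff n (p - p') : ℝ) : ℂ) * x ^ n =
      ((coeff n p : ℝ) : ℂ) * x ^ n - ((coeff n p' : ℝ) : ℂ) * x ^ n := by
    intro n; rw [map_sub]; push_cast; ring
  refine ⟨?_, ?_⟩
  · simp only [he]
    exact Summable.of_nonneg_of_le (fun _ => norm_nonneg _) (fun _ => norm_sub_le _ _)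
      (h.1.add h'.1)
  · simp only [he]
    exact h.2.sub h'.2

lemma mul (h : AbsHasSum p x a) (h' : AbsHasSum p' x a') : AbsHasSum (p * p') x (a * a') := by
  have he : ∀ n, ((coeff n (p * p') : ℝ) : ℂ) * x ^ n = ∑ kl ∈ antidiagonal n,
      (((coeff kl.1 p : ℝ) : ℂ) * x ^ kl.1) * (((coeff kl.2 p' : ℝ) : ℂ) * x ^ kl.2) := by
    intro n
    rw [coeff_mul]
    push_cast
    rw [Finset.sum_mul]
    refine Finset.sum_congr rfl fun kl hkl => ?_
    rw [← Finset.HasAntidiagonal.mem_antidiagonal.1 hkl, pow_add]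
    ring
  have hs := summable_norm_sum_mul_antidiagonal_of_summable_norm h.1 h'.1
  refine ⟨?_, ?_⟩
  · simpa only [he] using hs
  · simp only [he]
    rw [← h.2.tsum_eq, ← h'.2.tsum_eq,
      tsum_mul_tsum_eq_tsum_sum_antidiagonal_of_summable_norm h.1 h'.1]
    exact hs.of_norm.hasSum

lemma of_finite (p : ℝ⟦X⟧) (N : ℕ) (h : ∀ n, N ≤ n → coeff n p = 0) (x : ℂ) :
    AbsHasSum p x (∑ n ∈ Finset.range N, ((coeff n p : ℝ) : ℂ) * x ^ n) := by
  have h0 : ∀ n, n ∉ Finset.range N → ((coeff n p : ℝ) : ℂ) * x ^ n = 0 := by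
    intro n hn
    rw [h n (by simpa using hn)]
    simp
  exact ⟨summable_of_ne_finset_zero (s := Finset.range N) fun n hn => by rw [h0 n hn, norm_zero],
    hasSum_sum_of_ne_finset_zero h0⟩

lemma C (b : ℝ) (x : ℂ) : AbsHasSum (PowerSeries.C b) x b := by
  simpa [coeff_C] using of_finite (PowerSeries.C b) 1
    (fun n hn => by rw [coeff_C, if_neg (by omega)]) x

lemma one (x : ℂ) : AbsHasSum 1 x 1 := by
  simpa using AbsHasSum.C 1 x

lemma X (x : ℂ) : AbsHasSum X x x := by
  simpa [coeff_X, Finset.sum_range_succ] using of_finite PowerSeries.X 2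
    (fun n hn => by rw [coeff_X, if_neg (by omega)]) x

lemma pow (h : AbsHasSum p x a) (j : ℕ) : AbsHasSum (p ^ j) x (a ^ j) := by
  induction j with
  | zero => simpa using one x
  | succ j ih => simpa only [pow_succ] using ih.mul h

lemma rescale {b : ℝ} (h : AbsHasSum p (b * x) a) : AbsHasSum (PowerSeries.rescale b p) x a := by
  have he : ∀ n, ((coeff n (PowerSeries.rescale b p) : ℝ) : ℂ) * x ^ n =
      ((coeff n p : ℝ) : ℂ) * (b * x) ^ n := by
    intro n; rw [coeff_rescale]; push_cast; ring
  simpa only [AbsHasSum, he] using h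

end AbsHasSum

/-! ### The analytic function of the forest series -/

/-- The principal branch of `√(1 - x)`. -/
noncomputable def sqrtOneSub (x : ℂ) : ℂ := (1 - x) ^ (1 / 2 : ℂ)

lemma absHasSum_sqrtSeries {x : ℂ} (hx : ‖x‖ < 1) : AbsHasSum sqrtSeries x (sqrtOneSub x) := by
  have hp := Complex.one_add_cpow_hasFPowerSeriesOnBall_zero (a := (1 / 2 : ℂ))
  have hmem : -x ∈ Metric.eball (0 : ℂ) 1 := by
    rw [← ENNReal.ofReal_one, Metric.eball_ofReal]
    simpa using hx
  have he : ∀ n, (_root_.binomialSeries ℂ (1 / 2 : ℂ)) n (fun _ => -x) =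
      ((coeff n sqrtSeries : ℝ) : ℂ) * x ^ n := by
    intro n
    rw [coeff_sqrtSeries, binomialSeries_apply]
    push_cast
    simp [neg_pow x]
    ring
  refine ⟨?_, ?_⟩
  · have := (_root_.binomialSeries ℂ (1 / 2 : ℂ)).summable_norm_apply
      (Metric.eball_subset_eball hp.r_le hmem)
    simpa only [he, sqrtOneSub] using this
  · have := hp.hasSum hmem
    rw [zero_add, ← sub_eq_add_neg] at this
    simpa only [he, sqrtOneSub] using this

lemma sqrtOneSub_sq (x : ℂ) : sqrtOneSub x ^ 2 = 1 - x := by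
  rw [sqrtOneSub, one_div, Complex.cpow_ofNat_inv_pow]

lemma sqrtOneSub_re_nonneg (x : ℂ) : 0 ≤ (sqrtOneSub x).re := by
  by_cases h : 1 - x = 0
  · simp [sqrtOneSub, h]
  rw [sqrtOneSub, Complex.cpow_def_of_ne_zero h, Complex.exp_re]
  refine mul_nonneg (Real.exp_pos _).le (Real.cos_nonneg_of_mem_Icc ?_)
  have h1 : (Complex.log (1 - x) * (1 / 2)).im = Complex.arg (1 - x) / 2 := by
    rw [mul_comm, Complex.mul_im]
    norm_num [Complex.log_im]
    ring
  rw [h1]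
  have := Complex.neg_pi_lt_arg (1 - x)
  have := Complex.arg_le_pi (1 - x)
  constructor <;> linarith

lemma norm_sqrtOneSub_sq (x : ℂ) : ‖sqrtOneSub x‖ ^ 2 = ‖1 - x‖ := by
  rw [← norm_pow, sqrtOneSub_sq]

lemma sqrtOneSub_zero : sqrtOneSub 0 = 1 := by simp [sqrtOneSub]

lemma analyticAt_sqrtOneSub {x : ℂ} (hx : 1 - x ∈ Complex.slitPlane) :
    AnalyticAt ℂ sqrtOneSub x := by
  unfold sqrtOneSub
  exact (analyticAt_const.sub analyticAt_id).cpow analyticAt_const hx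

/-- The analytic function represented by `normSeries`. -/
noncomputable def normFun (x : ℂ) : ℂ :=
  ((4 * s)⁻¹ : ℝ) * (1 - (r⁻¹ : ℝ) * x - sqrtOneSub x * sqrtOneSub ((r⁻¹ ^ 2 : ℝ) * x))

lemma absHasSum_normSeries {x : ℂ} (hx : ‖x‖ < 1) : AbsHasSum normSeries x (normFun x) := by
  have hx' : ‖((r⁻¹ ^ 2 : ℝ) : ℂ) * x‖ < 1 := by
    rw [norm_mul, Complex.norm_real, Real.norm_of_nonneg (by positivity)]
    have := r_inv_sq_lt_one
    nlinarith [norm_nonneg x, sq_nonneg r⁻¹]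
  exact (AbsHasSum.C _ x).mul ((((AbsHasSum.one x).sub ((AbsHasSum.C _ x).mul (AbsHasSum.X x))).sub
    ((absHasSum_sqrtSeries hx).mul (absHasSum_sqrtSeries hx').rescale)))

lemma one_sub_mul_mem_slitPlane {x : ℂ} {b : ℝ} (h0 : 0 ≤ b) (h1 : b ≤ 1)
    (hx : 1 - x ∈ Complex.slitPlane) : 1 - b * x ∈ Complex.slitPlane := by
  rw [Complex.mem_slitPlane_iff] at hx ⊢
  simp only [Complex.sub_re, Complex.one_re, Complex.sub_im, Complex.one_im, Complex.re_ofReal_mul,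
    Complex.im_ofReal_mul, zero_sub, ne_eq, neg_eq_zero, sub_pos] at hx ⊢
  rcases h0.eq_or_lt with rfl | h0
  · simp
  rcases hx with h | h
  · left; nlinarith
  · right; exact mul_ne_zero h0.ne' h

lemma analyticAt_normFun {x : ℂ} (hx : 1 - x ∈ Complex.slitPlane) : AnalyticAt ℂ normFun x := by
  have h2 := analyticAt_sqrtOneSub
    (one_sub_mul_mem_slitPlane (sq_nonneg r⁻¹) r_inv_sq_lt_one.le hx)
  have h3 : AnalyticAt ℂ (fun x => sqrtOneSub ((r⁻¹ ^ 2 : ℝ) * x)) x :=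
    h2.fun_comp (analyticAt_const.mul analyticAt_id)
  unfold normFun
  exact analyticAt_const.mul (((analyticAt_const.sub (analyticAt_const.mul analyticAt_id))).sub
    ((analyticAt_sqrtOneSub hx).mul h3))

lemma normFun_zero : normFun 0 = 0 := by
  simp [normFun, sqrtOneSub_zero]

lemma normFun_quadratic (x : ℂ) : (2 * s : ℝ) * normFun x * (1 - (2 * s : ℝ) * normFun x) =
    (r⁻¹ : ℝ) * x * (1 + (2 * s : ℝ) * normFun x) := by
  have hs : (s : ℂ) ≠ 0 := by exact_mod_cast s_pos.ne'
  have h1 : (2 * s : ℝ) * normFun x = (1 / 2) *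
      (1 - (r⁻¹ : ℝ) * x - sqrtOneSub x * sqrtOneSub ((r⁻¹ ^ 2 : ℝ) * x)) := by
    rw [normFun]
    push_cast
    field_simp
    norm_num
  have h2 := sqrtOneSub_sq x
  have h3 := sqrtOneSub_sq ((r⁻¹ ^ 2 : ℝ) * x)
  have h4 : (r⁻¹ : ℂ) ^ 2 + 1 = 6 * (r⁻¹ : ℂ) := by
    have := congrArg (fun y => y * r⁻¹) r_add_inv
    simp only [add_mul, mul_inv_cancel₀ r_ne_zero] at this
    exact_mod_cast (show r⁻¹ ^ 2 + 1 = 6 * r⁻¹ by linarith)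
  rw [h1]
  push_cast at h3 ⊢
  generalize sqrtOneSub x = w at *
  generalize sqrtOneSub ((r : ℂ)⁻¹ ^ 2 * x) = t at *
  linear_combination (-1 / 4 * t ^ 2) * h2 - (1 / 4) * (1 - x) * h3 + (1/4) * x * h4

lemma re_lt_one_of_norm_le_one {x : ℂ} (hx : ‖x‖ ≤ 1) (h1 : x ≠ 1) : x.re < 1 := by
  refine lt_of_le_of_ne ((Complex.re_le_norm x).trans hx) fun h => h1 ?_
  have h2 := Complex.sq_norm x
  rw [Complex.normSq_apply, h] at h2
  have h3 : x.im = 0 := by nlinarith [norm_nonneg x, mul_self_nonneg x.im]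
  exact Complex.ext h h3

lemma one_sub_mem_slitPlane {x : ℂ} (hx : ‖x‖ ≤ 1) (h1 : x ≠ 1) : 1 - x ∈ Complex.slitPlane := by
  left
  simpa using re_lt_one_of_norm_le_one hx h1

/-- If `|v| = 1` for `v = normFun x`, the equation
`2 s v (1 - 2 s v) = (x / r) (1 + 2 s v)` and the triangle inequality give `|x| ≥ 1`, with equality
only for `v = 1`. -/
lemma eq_one_of_norm_normFun_eq_one {x : ℂ} (hx : ‖x‖ ≤ 1) (h : ‖normFun x‖ = 1) : x = 1 := by
  have hq := normFun_quadratic x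
  set v := normFun x
  have hs := s_pos
  have hr := r_inv_pos
  have h4 := four_s
  have h5 := r_inv
  have hρ : 2 * s * (1 - 2 * s) = r⁻¹ * (1 + 2 * s) := by
    rw [h5] at h4 ⊢
    linear_combination (-2 * s) * h4
  have hn := congrArg norm hq
  simp only [norm_mul, Complex.norm_real, Real.norm_of_nonneg hr.le,
    Real.norm_of_nonneg (show 0 ≤ 2 * s by positivity), h, mul_one] at hn
  have h6 : 1 - 2 * s ≤ ‖1 - (2 * s : ℝ) * v‖ := by
    refine le_trans ?_ (norm_sub_norm_le _ _)
    rw [norm_mul, h, Complex.norm_real, Real.norm_of_nonneg (by positivity)]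
    simp
  have h7 : 1 + 2 * s ≤ ‖1 + (2 * s : ℝ) * v‖ := by
    have h8 : r⁻¹ * (1 + 2 * s) ≤ r⁻¹ * ‖1 + (2 * s : ℝ) * v‖ := by
      calc r⁻¹ * (1 + 2 * s) = 2 * s * (1 - 2 * s) := hρ.symm
        _ ≤ 2 * s * ‖1 - (2 * s : ℝ) * v‖ := by gcongr
        _ = r⁻¹ * ‖x‖ * ‖1 + (2 * s : ℝ) * v‖ := hn
        _ ≤ r⁻¹ * 1 * ‖1 + (2 * s : ℝ) * v‖ := by gcongr
        _ = _ := by ring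
    exact le_of_mul_le_mul_left h8 hr
  have hv1 : v = 1 := by
    by_contra hne
    have h8 := re_lt_one_of_norm_le_one h.le hne
    have h9 := Complex.sq_norm (1 + (2 * s : ℝ) * v)
    have h10 := Complex.sq_norm v
    rw [h, Complex.normSq_apply] at h10
    rw [Complex.normSq_apply] at h9
    simp only [Complex.add_re, Complex.one_re, Complex.re_ofReal_mul, Complex.add_im,
      Complex.one_im, Complex.im_ofReal_mul, zero_add] at h9
    nlinarith
  rw [hv1] at hq
  have hq' : ((2 * s * (1 - 2 * s) : ℝ) : ℂ) = ((r⁻¹ * (1 + 2 * s) : ℝ) : ℂ) * x := by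
    push_cast at hq ⊢
    linear_combination hq
  rw [hρ] at hq'
  have hne : ((r⁻¹ * (1 + 2 * s) : ℝ) : ℂ) ≠ 0 := by
    exact_mod_cast (show (r⁻¹ * (1 + 2 * s) : ℝ) ≠ 0 by positivity)
  exact mul_left_cancel₀ hne (by rw [← hq', mul_one])

/-- On the closed unit disc `normFun` takes values in the open unit disc, except at `1`: the
algebraic equation allows modulus `1` only at `1`, and a segment joins any other point to `0`. -/
lemma norm_normFun_lt_one {x : ℂ} (hx : ‖x‖ ≤ 1) (h1 : x ≠ 1) : ‖normFun x‖ < 1 := by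
  by_contra! hge
  have hcont : ContinuousOn (fun t : ℝ => ‖normFun (t * x)‖) (Set.Icc 0 1) := by
    intro t ht
    have h2 : AnalyticAt ℂ normFun (t * x) :=
      analyticAt_normFun (one_sub_mul_mem_slitPlane ht.1 ht.2 (one_sub_mem_slitPlane hx h1))
    have h3 : ContinuousAt (fun t : ℝ => normFun (t * x)) t :=
      ContinuousAt.comp (f := fun t : ℝ => (t : ℂ) * x) h2.continuousAt (by fun_prop)
    exact h3.norm.continuousWithinAt
  obtain ⟨t, ht, h2⟩ := intermediate_value_Icc zero_le_one hcont
    (show (1 : ℝ) ∈ Set.Icc _ _ by simpa [normFun_zero] using hge)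
  have htx : ‖(t : ℂ) * x‖ = t * ‖x‖ := by
    rw [norm_mul, Complex.norm_real, Real.norm_of_nonneg ht.1]
  have h3 := eq_one_of_norm_normFun_eq_one (by rw [htx]; nlinarith [norm_nonneg x, ht.1, ht.2]) h2
  have h4 : t = 1 := by
    have h5 := congrArg norm h3
    rw [htx, norm_one] at h5
    nlinarith [norm_nonneg x, ht.1, ht.2]
  rw [h4, Complex.ofReal_one, one_mul] at h3
  exact h1 h3

/-- The partial sums at `x < 1` are at most `normFun x < 1`; let `x` tend to `1`. -/
lemma sum_coeff_normSeries_le_one (N : ℕ) :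
    ∑ n ∈ Finset.range N, coeff n normSeries ≤ 1 := by
  have h0 : ∀ n, 0 ≤ coeff n normSeries := fun n => by
    simpa using coeff_normSeries_pow_nonneg n 1
  have h1 : ∀ x ∈ Set.Ioo (0 : ℝ) 1, ∑ n ∈ Finset.range N, coeff n normSeries * x ^ n ≤ 1 := by
    intro x hx
    have hx1 : ‖(x : ℂ)‖ < 1 := by
      rw [Complex.norm_real, Real.norm_of_nonneg hx.1.le]; exact hx.2
    have h2 := (absHasSum_normSeries hx1).2
    have h3 : HasSum (fun n => coeff n normSeries * x ^ n) (normFun x).re := by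
      simpa only [← Complex.ofReal_pow, ← Complex.ofReal_mul, Complex.ofReal_re] using
        Complex.hasSum_re h2
    refine (sum_le_hasSum _ (fun n _ => mul_nonneg (h0 n) (pow_nonneg hx.1.le n)) h3).trans ?_
    refine (Complex.re_le_norm _).trans (norm_normFun_lt_one hx1.le ?_).le
    exact_mod_cast hx.2.ne
  have hcont : Continuous fun x : ℝ => ∑ n ∈ Finset.range N, coeff n normSeries * x ^ n := by
    fun_prop
  have h4 := (hcont.tendsto 1).mono_left (nhdsWithin_le_nhds (s := Set.Iio 1))
  have h5 := le_of_tendsto h4 (Filter.eventually_of_mem (Ioo_mem_nhdsLT zero_lt_one) h1)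
  simpa using h5

/-! ### Bounded and summable coefficients -/

/-- The coefficients of `p` are bounded. -/
def BddCoeff (p : ℝ⟦X⟧) : Prop := ∃ B, ∀ n, |coeff n p| ≤ B

/-- The coefficients of `p` are absolutely summable. -/
def SummableCoeff (p : ℝ⟦X⟧) : Prop := Summable fun n => |coeff n p|

lemma BddCoeff.nonneg_bound {p : ℝ⟦X⟧} (h : BddCoeff p) : ∃ B, 0 ≤ B ∧ ∀ n, |coeff n p| ≤ B := by
  obtain ⟨B, hB⟩ := h
  exact ⟨B, (abs_nonneg _).trans (hB 0), hB⟩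

lemma BddCoeff.add {p p' : ℝ⟦X⟧} (h : BddCoeff p) (h' : BddCoeff p') : BddCoeff (p + p') := by
  obtain ⟨B, hB⟩ := h
  obtain ⟨B', hB'⟩ := h'
  exact ⟨B + B', fun n => by
    rw [map_add]; exact (abs_add_le _ _).trans (add_le_add (hB n) (hB' n))⟩

lemma BddCoeff.neg {p : ℝ⟦X⟧} (h : BddCoeff p) : BddCoeff (-p) := by
  simpa [BddCoeff] using h

lemma BddCoeff.sub {p p' : ℝ⟦X⟧} (h : BddCoeff p) (h' : BddCoeff p') : BddCoeff (p - p') := by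
  rw [sub_eq_add_neg]; exact h.add h'.neg

/-- An explicit form of `BddCoeff.mul`, in which only partial sums of the second factor occur. -/
lemma abs_coeff_mul_le {p p' : ℝ⟦X⟧} {B K : ℝ} (hB0 : 0 ≤ B) (h : ∀ n, |coeff n p| ≤ B)
    (h' : ∀ N, ∑ n ∈ Finset.range N, |coeff n p'| ≤ K) (n : ℕ) : |coeff n (p * p')| ≤ B * K := by
  rw [coeff_mul]
  calc _ ≤ ∑ kl ∈ antidiagonal n, |coeff kl.1 p * coeff kl.2 p'| := Finset.abs_sum_le_sum_abs _ _
    _ ≤ ∑ kl ∈ antidiagonal n, B * |coeff kl.2 p'| := by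
        refine Finset.sum_le_sum fun kl _ => ?_
        rw [abs_mul]
        exact mul_le_mul_of_nonneg_right (h _) (abs_nonneg _)
    _ = B * ∑ i ∈ Finset.range (n + 1), |coeff i p'| := by
        rw [← Finset.mul_sum, ← Finset.Nat.sum_antidiagonal_eq_sum_range_succ_mk
          (fun kl => |coeff kl.1 p'|)]
        exact congrArg _ (Finset.Nat.sum_antidiagonal_swap (n := n)
          (f := fun kl => |coeff kl.2 p'|)).symm
    _ ≤ B * K := mul_le_mul_of_nonneg_left (h' _) hB0

lemma BddCoeff.mul {p p' : ℝ⟦X⟧} (h : BddCoeff p) (h' : SummableCoeff p') : BddCoeff (p * p') := by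
  obtain ⟨B, hB0, hB⟩ := h.nonneg_bound
  exact ⟨_, abs_coeff_mul_le hB0 hB fun N => h'.sum_le_tsum _ fun _ _ => abs_nonneg _⟩

lemma SummableCoeff.bddCoeff {p : ℝ⟦X⟧} (h : SummableCoeff p) : BddCoeff p :=
  ⟨∑' n, |coeff n p|, fun n => h.le_tsum n fun _ _ => abs_nonneg _⟩

lemma SummableCoeff.add {p p' : ℝ⟦X⟧} (h : SummableCoeff p) (h' : SummableCoeff p') :
    SummableCoeff (p + p') :=
  Summable.of_nonneg_of_le (fun _ => abs_nonneg _)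
    (fun n => by rw [map_add]; exact abs_add_le _ _) (Summable.add h h')

lemma SummableCoeff.C (b : ℝ) : SummableCoeff (C b) :=
  summable_of_ne_finset_zero (s := {0}) fun n hn => by
    rw [coeff_C, if_neg (by simpa using hn), abs_zero]

lemma SummableCoeff.C_mul {p : ℝ⟦X⟧} (h : SummableCoeff p) (b : ℝ) :
    SummableCoeff (PowerSeries.C b * p) := by
  simpa [SummableCoeff, abs_mul] using Summable.mul_left |b| h

lemma SummableCoeff.X : SummableCoeff X :=
  summable_of_ne_finset_zero (s := {1}) fun n hn => by
    rw [coeff_X, if_neg (by simpa using hn), abs_zero]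

lemma BddCoeff.C_mul {p : ℝ⟦X⟧} (h : BddCoeff p) (b : ℝ) : BddCoeff (C b * p) := by
  rw [mul_comm]; exact h.mul (.C b)

/-- Series with geometrically small coefficients, and their derivatives, have summable
coefficients. -/
lemma summableCoeff_iterate_derivative_of_le {p : ℝ⟦X⟧} {K ρ : ℝ} (h0 : 0 < ρ) (h1 : ρ < 1)
    (h : ∀ n, |coeff n p| ≤ K * ρ ^ n) :
    SummableCoeff p ∧ SummableCoeff (d⁄dX ℝ p) ∧ SummableCoeff (d⁄dX ℝ (d⁄dX ℝ p)) := by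
  have hρ : ‖ρ‖ < 1 := by rwa [Real.norm_of_nonneg h0.le]
  have hs : ∀ k : ℕ, Summable fun n : ℕ => K * ((n : ℝ) ^ k * ρ ^ n) := fun k =>
    (summable_pow_mul_geometric_of_norm_lt_one k hρ).mul_left K
  refine ⟨?_, ?_, ?_⟩
  · refine Summable.of_nonneg_of_le (fun _ => abs_nonneg _) h ?_
    simpa using hs 0
  · refine Summable.of_nonneg_of_le (fun _ => abs_nonneg _) (fun n => ?_)
      ((summable_nat_add_iff 1).2 (hs 1))
    rw [coeff_derivative, abs_mul, abs_of_nonneg (by positivity : (0 : ℝ) ≤ n + 1)]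
    calc _ ≤ K * ρ ^ (n + 1) * ((n : ℝ) + 1) := by gcongr; exact h _
      _ = _ := by push_cast; ring
  · refine Summable.of_nonneg_of_le (fun _ => abs_nonneg _) (fun n => ?_)
      ((summable_nat_add_iff 2).2 (hs 2))
    rw [coeff_derivative, coeff_derivative, abs_mul, abs_mul,
      abs_of_nonneg (by positivity : (0 : ℝ) ≤ n + 1),
      abs_of_nonneg (by positivity : (0 : ℝ) ≤ ((n + 1 : ℕ) : ℝ) + 1)]
    have hK : 0 ≤ K * ρ ^ (n + 2) := (abs_nonneg _).trans (h (n + 2))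
    calc _ ≤ K * ρ ^ (n + 2) * (((n + 1 : ℕ) : ℝ) + 1) * ((n : ℝ) + 1) := by gcongr; exact h _
      _ ≤ K * ρ ^ (n + 2) * (((n + 1 : ℕ) : ℝ) + 1) * ((n : ℝ) + 2) := by gcongr; norm_num
      _ = _ := by push_cast; ring

/-! ### The coefficients of the square root -/

lemma coeff_succ_sqrtSeries (n : ℕ) :
    2 * ((n : ℝ) + 1) * coeff (n + 1) sqrtSeries = (2 * n - 1) * coeff n sqrtSeries := by
  have h := congrArg (coeff n) derivative_sqrtSeries
  rw [map_neg, mul_assoc, ← map_ofNat (C (R := ℝ)) 2, coeff_C_mul, sub_mul, one_mul, map_sub,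
    coeff_derivative] at h
  cases n with
  | zero =>
    rw [coeff_zero_X_mul] at h
    push_cast
    linear_combination h
  | succ n =>
    rw [coeff_succ_X_mul, coeff_derivative] at h
    push_cast at h ⊢
    linear_combination h

/-- The coefficients of `√(1 - x)` are given by the Wallis product. -/
lemma coeff_succ_sqrtSeries_wallis (n : ℕ) :
    coeff (n + 1) sqrtSeries < 0 ∧
    (2 * ((n : ℝ) + 1) * coeff (n + 1) sqrtSeries) ^ 2 * (2 * n + 1) * Real.Wallis.W n = 1 := by
  induction n with
  | zero =>
    have h := coeff_succ_sqrtSeries 0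
    rw [coeff_zero_sqrtSeries] at h
    norm_num at h ⊢
    have h2 : coeff 1 sqrtSeries = -1 / 2 := by linarith
    rw [h2]
    norm_num [Real.Wallis.W]
  | succ n ih =>
    have h := coeff_succ_sqrtSeries (n + 1)
    obtain ⟨h1, h2⟩ := ih
    push_cast at h ⊢
    constructor
    · by_contra! h3
      nlinarith [mul_nonneg (show (0 : ℝ) ≤ 2 * (n + 1 + 1) by positivity) h3,
        mul_neg_of_pos_of_neg (show (0 : ℝ) < 2 * (n + 1) - 1 by
          have : (0 : ℝ) ≤ n := n.cast_nonneg
          linarith) h1]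
    · refine Eq.trans ?_ h2
      rw [Real.Wallis.W_succ, h]
      field_simp
      ring

lemma coeff_succ_sqrtSeries_eq (n : ℕ) :
    2 * ((n : ℝ) + 1) * coeff (n + 1) sqrtSeries = -(√((2 * n + 1) * Real.Wallis.W n))⁻¹ := by
  obtain ⟨h1, h2⟩ := coeff_succ_sqrtSeries_wallis n
  have hW := Real.Wallis.W_pos n
  have h3 : (2 * ((n : ℝ) + 1) * coeff (n + 1) sqrtSeries) ^ 2 =
      ((2 * n + 1) * Real.Wallis.W n)⁻¹ :=
    eq_inv_of_mul_eq_one_left (by linear_combination h2)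
  rw [← Real.sqrt_inv, ← h3, Real.sqrt_sq_eq_abs, abs_of_neg, neg_neg]
  exact mul_neg_of_pos_of_neg (by positivity) h1

/-- The coefficients of `√(1 - x)` are `-n ^ (-3/2) / (2 √π)` up to `O(n ^ (-2))`. -/
lemma coeff_sqrtSeries_asymp (n : ℕ) :
    |coeff (n + 1) sqrtSeries + (2 * √Real.pi)⁻¹ * ((n + 1 : ℕ) : ℝ) ^ (-3 / 2 : ℝ)| ≤
      1 / ((n + 1 : ℕ) : ℝ) ^ 2 := by
  have hπ := Real.pi_gt_three
  have hW := Real.Wallis.W_pos n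
  have hW1 := Real.Wallis.W_le n
  have hW2 := Real.Wallis.le_W n
  set m : ℝ := ((n + 1 : ℕ) : ℝ) with hm
  have hn : (n : ℝ) = m - 1 := by rw [hm]; push_cast; ring
  have hm1 : 1 ≤ m := by rw [hm]; push_cast; linarith [n.cast_nonneg (α := ℝ)]
  have h1 := coeff_succ_sqrtSeries_eq n
  rw [hn] at h1 hW2
  set w := √((2 * (m - 1) + 1) * Real.Wallis.W n)
  set b := coeff (n + 1) sqrtSeries
  have hpow : m ^ (-3 / 2 : ℝ) = (m * √m)⁻¹ := by
    rw [show (-3 / 2 : ℝ) = -(1 + 1 / 2) by norm_num, Real.rpow_neg (by positivity),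
      Real.rpow_add (by positivity), Real.rpow_one, Real.sqrt_eq_rpow]
  -- `w` lies between `√(π (m - 1/2)^2 / m)` and `√(π m)`
  have hw1 : w ≤ √Real.pi * √m := by
    rw [← Real.sqrt_mul (by positivity)]
    apply Real.sqrt_le_sqrt
    nlinarith
  have hw2 : √Real.pi * (m - 1 / 2) ≤ w * √m := by
    rw [← Real.sqrt_mul (by nlinarith)]
    apply Real.le_sqrt_of_sq_le
    rw [mul_pow, Real.sq_sqrt (by positivity)]
    have h3 : (2 * (m - 1) + 1) * (Real.pi / 2) ≤ Real.Wallis.W n * (2 * m) := by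
      have := mul_le_mul_of_nonneg_right hW2 (show 0 ≤ 2 * m by positivity)
      refine le_trans (le_of_eq ?_) this
      rw [show 2 * (m - 1) + 2 = 2 * m by ring]
      field_simp
    nlinarith
  have hs1 : 0 < √m := by positivity
  have hsq : √m * √m = m := Real.mul_self_sqrt (by positivity)
  have hp0 : 1 ≤ √Real.pi := Real.one_le_sqrt.2 (by linarith)
  have hw0 : 0 < w := Real.sqrt_pos.2 (by nlinarith)
  have hb : b = -(2 * m * w)⁻¹ := by
    have : 2 * m * b = -w⁻¹ := by rw [← h1]; ring
    field_simp at this ⊢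
    linarith
  rw [hpow, hb]
  have e1 : -(2 * m * w)⁻¹ + (2 * √Real.pi)⁻¹ * (m * √m)⁻¹ =
      -((√Real.pi * √m - w) / (2 * m * w * (√Real.pi * √m))) := by
    field_simp
    ring
  rw [e1, abs_neg, abs_of_nonneg (div_nonneg (by linarith) (by positivity)),
    div_le_div_iff₀ (by positivity) (by positivity)]
  have h4 : (√Real.pi * √m - w) * √m ≤ √Real.pi / 2 := by nlinarith
  have h5 : 1 / 2 * √m ≤ w := by
    refine le_of_mul_le_mul_right ?_ hs1
    nlinarith
  have h6 : (√Real.pi * √m - w) * m ≤ √Real.pi * w := by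
    calc (√Real.pi * √m - w) * m = (√Real.pi * √m - w) * √m * √m := by rw [mul_assoc, hsq]
      _ ≤ √Real.pi / 2 * √m := by gcongr
      _ ≤ √Real.pi * w := by nlinarith
  have h7 : (√Real.pi * √m - w) * m * m ≤ √Real.pi * w * m := by gcongr
  have h8 : √Real.pi * w * m * 1 ≤ √Real.pi * w * m * √m := by
    gcongr
    exact Real.one_le_sqrt.2 hm1
  nlinarith [mul_pos (mul_pos (by linarith : 0 < √Real.pi) hw0) (mul_pos (by linarith : 0 < m) hs1)]

lemma abs_coeff_succ_mul_le (n : ℕ) : |coeff (n + 1) sqrtSeries * ((n : ℝ) + 1)| ≤ 1 / 2 := by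
  induction n with
  | zero =>
    have h := coeff_succ_sqrtSeries 0
    rw [coeff_zero_sqrtSeries] at h
    norm_num at h ⊢
    have h2 : coeff 1 sqrtSeries = -1 / 2 := by linarith
    rw [h2]
    norm_num
  | succ n ih =>
    have h := coeff_succ_sqrtSeries (n + 1)
    refine le_trans ?_ ih
    have h1 : coeff (n + 1 + 1) sqrtSeries * (((n + 1 : ℕ) : ℝ) + 1) =
        (2 * (n + 1) - 1) / (2 * (n + 1)) * (coeff (n + 1) sqrtSeries * ((n : ℝ) + 1)) := by
      push_cast at h ⊢
      field_simp
      linarith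
    rw [h1, abs_mul]
    refine mul_le_of_le_one_left (abs_nonneg _) ?_
    have hn : (0 : ℝ) ≤ n := n.cast_nonneg
    rw [abs_of_nonneg (div_nonneg (by linarith) (by linarith)), div_le_one (by linarith)]
    linarith

lemma bddCoeff_derivative_sqrtSeries : BddCoeff (d⁄dX ℝ sqrtSeries) :=
  ⟨1 / 2, fun n => by rw [coeff_derivative]; exact abs_coeff_succ_mul_le n⟩

lemma abs_coeff_sqrtSeries_le (n : ℕ) : |coeff n sqrtSeries| ≤ 1 := by
  cases n with
  | zero => rw [coeff_zero_sqrtSeries]; norm_num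
  | succ n =>
    have h := abs_coeff_succ_mul_le n
    rw [abs_mul, abs_of_nonneg (by positivity : (0 : ℝ) ≤ n + 1)] at h
    nlinarith [abs_nonneg (coeff (n + 1) sqrtSeries), n.cast_nonneg (α := ℝ)]

lemma bddCoeff_sqrtSeries : BddCoeff sqrtSeries := ⟨1, abs_coeff_sqrtSeries_le⟩

/-! ### The coefficients of the forest series -/

/-- The value of `√(1 - x / r ^ 2)` at `1`. -/
noncomputable def sqrtAtOne : ℝ := √(1 - r⁻¹ ^ 2)

lemma sqrtAtOne_pos : 0 < sqrtAtOne := Real.sqrt_pos.2 (by have := r_inv_sq_lt_one; linarith)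

lemma abs_coeff_sqrtSeries'_le (n : ℕ) : |coeff n sqrtSeries'| ≤ 1 * (r⁻¹ ^ 2) ^ n := by
  have := abs_coeff_sqrtSeries_le n
  have h0 : 0 ≤ (r⁻¹ ^ 2) ^ n := by positivity
  rw [coeff_sqrtSeries', abs_mul, abs_of_nonneg h0]
  nlinarith

lemma r_inv_sq_pos : 0 < r⁻¹ ^ 2 := pow_pos r_inv_pos 2

lemma hasSum_coeff_sqrtSeries' : HasSum (fun n => coeff n sqrtSeries') sqrtAtOne := by
  have hc : ‖((r⁻¹ ^ 2 : ℝ) : ℂ)‖ < 1 := by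
    rw [Complex.norm_real, Real.norm_of_nonneg r_inv_sq_pos.le]
    exact r_inv_sq_lt_one
  have h1 : (sqrtOneSub ((r⁻¹ ^ 2 : ℝ) : ℂ)) = (sqrtAtOne : ℂ) := by
    rw [sqrtAtOne, Real.sqrt_eq_rpow, Complex.ofReal_cpow (by linarith [r_inv_sq_lt_one]),
      sqrtOneSub]
    push_cast
    rfl
  have h2 := Complex.hasSum_re (absHasSum_sqrtSeries hc).2
  rw [h1] at h2
  simp only [← Complex.ofReal_pow, ← Complex.ofReal_mul, Complex.ofReal_re] at h2
  refine h2.congr_fun fun n => ?_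
  rw [coeff_sqrtSeries', mul_comm]

/-- The series `(√(1 - 1 / r ^ 2) - √(1 - x / r ^ 2)) / (1 - x)`. -/
noncomputable def tailSeries : ℝ⟦X⟧ :=
  mk fun n => sqrtAtOne - ∑ i ∈ Finset.range (n + 1), coeff i sqrtSeries'

lemma one_sub_X_mul_tailSeries : (1 - X) * tailSeries = C sqrtAtOne - sqrtSeries' := by
  ext n
  rw [sub_mul, one_mul, map_sub, map_sub, coeff_C]
  cases n with
  | zero => simp [tailSeries]
  | succ n =>
    rw [coeff_succ_X_mul, tailSeries, coeff_mk, coeff_mk, Finset.sum_range_succ _ (n + 1)]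
    simp

lemma abs_coeff_tailSeries_le (n : ℕ) :
    |coeff n tailSeries| ≤ r⁻¹ ^ 2 / (1 - r⁻¹ ^ 2) * (r⁻¹ ^ 2) ^ n := by
  have h := norm_sub_le_of_geometric_bound_of_hasSum r_inv_sq_lt_one
    (fun n => by rw [Real.norm_eq_abs]; exact abs_coeff_sqrtSeries'_le n)
    hasSum_coeff_sqrtSeries' (n + 1)
  rw [tailSeries, coeff_mk, abs_sub_comm]
  refine h.trans (le_of_eq ?_)
  ring

/-- The difference between `√((1 - x) (1 - x / r ^ 2))` and its leading term at `1` is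
`(1 - x) ^ (3/2)` times a function analytic beyond the unit disc. -/
lemma discSeries_sub : discSeries - C sqrtAtOne * sqrtSeries =
    -((1 - X) * sqrtSeries * tailSeries) := by
  rw [discSeries]
  linear_combination sqrtSeries * one_sub_X_mul_tailSeries

lemma derivative_one_sub_X_mul_sqrtSeries :
    d⁄dX ℝ ((1 - X) * sqrtSeries) = C (-3 / 2) * sqrtSeries := by
  have h := derivative_sqrtSeries
  have h2 : (2 : ℝ⟦X⟧) * C (-3 / 2) = -3 := by
    rw [← map_ofNat (C (R := ℝ)) 2, ← map_mul, ← map_ofNat (C (R := ℝ)) 3, ← map_neg]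
    norm_num
  have h3 : (C (1 / 2) : ℝ⟦X⟧) * 2 = 1 := by
    rw [← map_ofNat (C (R := ℝ)) 2, ← map_mul]
    norm_num
  have h4 : d⁄dX ℝ ((1 - X) * sqrtSeries) = -sqrtSeries + (1 - X) * d⁄dX ℝ sqrtSeries := by
    rw [Derivation.leibniz, map_sub, derivative_one, derivative_X, smul_eq_mul, smul_eq_mul]
    ring
  rw [h4]
  linear_combination C (1 / 2) * h - C (1 / 2) * sqrtSeries * h2 -
    (-sqrtSeries + (1 - X) * d⁄dX ℝ sqrtSeries - C (-3 / 2) * sqrtSeries) * h3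

lemma derivative_C_mul (b : ℝ) (p : ℝ⟦X⟧) : d⁄dX ℝ (C b * p) = C b * d⁄dX ℝ p := by
  rw [Derivation.leibniz, derivative_C]
  simp

lemma bddCoeff_derivative2_discSeries_sub :
    BddCoeff (d⁄dX ℝ (d⁄dX ℝ (discSeries - C sqrtAtOne * sqrtSeries))) := by
  obtain ⟨h0, h1, h2⟩ := summableCoeff_iterate_derivative_of_le r_inv_sq_pos r_inv_sq_lt_one
    abs_coeff_tailSeries_le
  have hθ : BddCoeff ((1 - X) * sqrtSeries) := by
    rw [sub_mul, one_mul, mul_comm X]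
    exact bddCoeff_sqrtSeries.sub (bddCoeff_sqrtSeries.mul .X)
  have he : d⁄dX ℝ (d⁄dX ℝ (discSeries - C sqrtAtOne * sqrtSeries)) =
      -(C (-3 / 2) * (d⁄dX ℝ sqrtSeries * tailSeries) +
        C (2 * (-3 / 2)) * (sqrtSeries * d⁄dX ℝ tailSeries) +
        (1 - X) * sqrtSeries * d⁄dX ℝ (d⁄dX ℝ tailSeries)) := by
    rw [discSeries_sub, map_neg, map_neg, Derivation.leibniz _ ((1 - X) * sqrtSeries),
      derivative_one_sub_X_mul_sqrtSeries]
    simp only [smul_eq_mul, map_add]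
    rw [Derivation.leibniz _ ((1 - X) * sqrtSeries), derivative_one_sub_X_mul_sqrtSeries,
      Derivation.leibniz _ tailSeries, derivative_C_mul]
    simp only [smul_eq_mul, map_mul, map_ofNat]
    ring
  rw [he]
  exact ((((bddCoeff_derivative_sqrtSeries.mul h0).C_mul _).add
    ((bddCoeff_sqrtSeries.mul h1).C_mul _)).add (hθ.mul h2)).neg

/-- Two bounded derivatives make the coefficients `O(n ^ (-2))`. -/
lemma abs_coeff_succ_le_of_derivative2 {p : ℝ⟦X⟧} {B B₁ : ℝ}
    (h : ∀ n, |coeff n (d⁄dX ℝ (d⁄dX ℝ p))| ≤ B) (h1 : |coeff 1 p| ≤ B₁) (m : ℕ) :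
    |coeff (m + 1) p| ≤ (2 * B + B₁) / ((m + 1 : ℕ) : ℝ) ^ 2 := by
  have hB : 0 ≤ B := (abs_nonneg _).trans (h 0)
  have hB1 : 0 ≤ B₁ := (abs_nonneg _).trans h1
  rw [le_div_iff₀ (by positivity)]
  cases m with
  | zero => norm_num; linarith
  | succ m =>
    have h2 := h m
    have hm : (0 : ℝ) ≤ m := m.cast_nonneg
    rw [coeff_derivative, coeff_derivative, abs_mul, abs_mul,
      abs_of_nonneg (by positivity : (0 : ℝ) ≤ m + 1),
      abs_of_nonneg (by positivity : (0 : ℝ) ≤ ((m + 1 : ℕ) : ℝ) + 1)] at h2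
    push_cast at h2 ⊢
    have h3 := abs_nonneg (coeff (m + 1 + 1) p)
    have h4 : |coeff (m + 1 + 1) p| * ((m : ℝ) + 1 + 1) ^ 2 ≤
        2 * (|coeff (m + 1 + 1) p| * ((m : ℝ) + 1 + 1) * ((m : ℝ) + 1)) := by
      nlinarith [mul_nonneg h3 (mul_nonneg hm (by linarith : (0 : ℝ) ≤ m + 1 + 1))]
    linarith

lemma C_mul_normSeries : C (4 * s) * normSeries = 1 - C r⁻¹ * X - discSeries := by
  rw [normSeries, ← mul_assoc, ← map_mul, mul_inv_cancel₀ (by have := s_pos; positivity), map_one,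
    one_mul]

/-- The coefficients of `normSeries` are a multiple of `n ^ (-3/2)`, up to `O(n ^ (-2))`. -/
lemma coeff_normSeries_asymp : ∃ B : ℝ, ∀ m : ℕ,
    |coeff (m + 1) normSeries -
      sqrtAtOne / (8 * s * √Real.pi) * ((m + 1 : ℕ) : ℝ) ^ (-3 / 2 : ℝ)| ≤
      B / ((m + 1 : ℕ) : ℝ) ^ 2 := by
  have hs := s_pos
  have hh := sqrtAtOne_pos
  have he : d⁄dX ℝ (d⁄dX ℝ (C (4 * s) * normSeries + C sqrtAtOne * sqrtSeries)) =
      -d⁄dX ℝ (d⁄dX ℝ (discSeries - C sqrtAtOne * sqrtSeries)) := by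
    rw [C_mul_normSeries, ← map_neg, ← map_neg]
    have : 1 - C r⁻¹ * X - discSeries + C sqrtAtOne * sqrtSeries =
      1 - C r⁻¹ * X + -(discSeries - C sqrtAtOne * sqrtSeries) := by ring
    rw [this, map_add, map_sub, derivative_one, derivative_C_mul, derivative_X, map_add, map_sub,
      mul_one, derivative_C]
    simp
  obtain ⟨B, hB⟩ := bddCoeff_derivative2_discSeries_sub.neg
  rw [← he] at hB
  refine ⟨(4 * s)⁻¹ * (2 * B + |coeff 1 (C (4 * s) * normSeries + C sqrtAtOne * sqrtSeries)| +
    sqrtAtOne), fun m => ?_⟩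
  have h1 := abs_coeff_succ_le_of_derivative2 hB le_rfl m
  have h2 := coeff_sqrtSeries_asymp m
  rw [map_add, coeff_C_mul, coeff_C_mul] at h1
  set u := ((m + 1 : ℕ) : ℝ) ^ (-3 / 2 : ℝ)
  have e1 : coeff (m + 1) normSeries - sqrtAtOne / (8 * s * √Real.pi) * u = (4 * s)⁻¹ *
      ((4 * s * coeff (m + 1) normSeries + sqrtAtOne * coeff (m + 1) sqrtSeries) -
        sqrtAtOne * (coeff (m + 1) sqrtSeries + (2 * √Real.pi)⁻¹ * u)) := by
    have : 0 < √Real.pi := Real.sqrt_pos.2 Real.pi_pos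
    field_simp
    ring
  rw [e1, abs_mul, abs_of_pos (by positivity : 0 < (4 * s)⁻¹), mul_div_assoc]
  refine mul_le_mul_of_nonneg_left ?_ (by positivity)
  refine (abs_sub _ _).trans ?_
  rw [abs_mul sqrtAtOne, abs_of_pos hh, add_div]
  refine add_le_add h1 ?_
  calc _ ≤ sqrtAtOne * (1 / ((m + 1 : ℕ) : ℝ) ^ 2) := by gcongr
    _ = _ := by ring

/-! ### The coefficients of the powers of the forest series -/

lemma geometric_one : (mk 1 : ℝ⟦X⟧) * (1 - X) = 1 := mk_one_mul_one_sub_eq_one ℝ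

lemma bddCoeff_mk_one : BddCoeff (mk 1 : ℝ⟦X⟧) := ⟨1, fun n => by simp⟩

lemma geometric_r : rescale (r⁻¹ ^ 2) (mk 1 : ℝ⟦X⟧) * (1 - C (r⁻¹ ^ 2) * X) = 1 := by
  rw [← rescale_X, ← map_one (rescale (r⁻¹ ^ 2)), ← map_sub, ← map_mul, geometric_one]

lemma summableCoeff_geometric_r : SummableCoeff (rescale (r⁻¹ ^ 2) (mk 1 : ℝ⟦X⟧)) :=
  (summableCoeff_iterate_derivative_of_le (K := 1) r_inv_sq_pos r_inv_sq_lt_one fun n => by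
    rw [coeff_rescale]
    simp [abs_of_pos r_pos]).1

lemma bddCoeff_discSeries : BddCoeff discSeries :=
  bddCoeff_sqrtSeries.mul (summableCoeff_iterate_derivative_of_le r_inv_sq_pos r_inv_sq_lt_one
    abs_coeff_sqrtSeries'_le).1

lemma bddCoeff_derivative_discSeries : BddCoeff (d⁄dX ℝ discSeries) := by
  obtain ⟨h0, h1, -⟩ := summableCoeff_iterate_derivative_of_le r_inv_sq_pos r_inv_sq_lt_one
    abs_coeff_sqrtSeries'_le
  rw [discSeries, Derivation.leibniz, smul_eq_mul, smul_eq_mul, mul_comm sqrtSeries' ]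
  exact (bddCoeff_sqrtSeries.mul h1).add (bddCoeff_derivative_sqrtSeries.mul h0)

lemma two_mul_discSeries_mul_derivative : 2 * discSeries * d⁄dX ℝ discSeries =
    C (-(1 + r⁻¹ ^ 2)) + C (2 * r⁻¹ ^ 2) * X := by
  have h := congrArg (d⁄dX ℝ) discSeries_sq
  rw [derivative_pow, Derivation.leibniz, map_sub, map_sub, derivative_one, derivative_C_mul,
    derivative_X] at h
  simp only [smul_eq_mul, Nat.cast_ofNat, pow_one, Nat.add_one_sub_one] at h
  rw [h]
  simp only [map_neg, map_add, map_one, map_mul, map_ofNat]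
  ring

/-- The equation for `discSeries ^ 2`, differentiated twice. -/
lemma discSeries_second : 2 * (d⁄dX ℝ discSeries) ^ 2 +
    2 * discSeries * d⁄dX ℝ (d⁄dX ℝ discSeries) = C (2 * r⁻¹ ^ 2) := by
  have h := congrArg (d⁄dX ℝ) two_mul_discSeries_mul_derivative
  rw [map_add, derivative_C, derivative_C_mul, derivative_X, Derivation.leibniz,
    ← map_ofNat (C (R := ℝ)) 2, derivative_C_mul] at h
  simp only [smul_eq_mul, zero_add, mul_one] at h
  rw [← h, ← map_ofNat (C (R := ℝ)) 2]
  ring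

/-- With `Q = discSeries`, `4 Q ^ 2 Q' ^ 2` is the square of a polynomial and `Q ^ 2` has simple
zeros at `1` and `r ^ 2`, so that `Q' ^ 2` has simple poles there. -/
lemma bddCoeff_derivative_discSeries_sq : BddCoeff ((d⁄dX ℝ discSeries) ^ 2) := by
  set D := d⁄dX ℝ discSeries
  set L : ℝ⟦X⟧ := C (-(1 + r⁻¹ ^ 2)) + C (2 * r⁻¹ ^ 2) * X
  have hL : SummableCoeff L := (SummableCoeff.C _).add (SummableCoeff.X.C_mul _)
  have h4 : (C (1 / 4) : ℝ⟦X⟧) * 4 = 1 := by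
    rw [← map_ofNat (C (R := ℝ)) 4, ← map_mul]
    norm_num
  have he : D ^ 2 = C (1 / 4) * (mk 1 * rescale (r⁻¹ ^ 2) (mk 1 : ℝ⟦X⟧) * L * L) := by
    have h1 : 4 * ((1 - X) * (1 - C (r⁻¹ ^ 2) * X)) * D ^ 2 = L * L := by
      have h0 : 2 * discSeries * D = L := two_mul_discSeries_mul_derivative
      rw [← discSeries_sq, ← h0]
      ring
    rw [mul_assoc _ L L, ← h1]
    linear_combination (-D ^ 2) * h4 - C (1 / 4) * 4 * D ^ 2 * geometric_one -
      C (1 / 4) * 4 * D ^ 2 * mk 1 * (1 - X) * geometric_r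
  rw [he]
  exact (((bddCoeff_mk_one.mul summableCoeff_geometric_r).mul hL).mul hL).C_mul _

lemma bddCoeff_discSeries_mul_derivative2 :
    BddCoeff (discSeries * d⁄dX ℝ (d⁄dX ℝ discSeries)) := by
  have h2 : (C (1 / 2) : ℝ⟦X⟧) * 2 = 1 := by
    rw [← map_ofNat (C (R := ℝ)) 2, ← map_mul]
    norm_num
  have he : discSeries * d⁄dX ℝ (d⁄dX ℝ discSeries) =
      C (1 / 2) * C (2 * r⁻¹ ^ 2) - (d⁄dX ℝ discSeries) ^ 2 := by
    linear_combination C (1 / 2) * discSeries_second - (discSeries * d⁄dX ℝ (d⁄dX ℝ discSeries) +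
      (d⁄dX ℝ discSeries) ^ 2) * h2
  rw [he]
  exact ((SummableCoeff.C _).bddCoeff.C_mul _).sub bddCoeff_derivative_discSeries_sq

/-- With `Q = discSeries`, `2 Q ^ 2 Q''` is a combination of `Q` and `Q'` with polynomial
coefficients, and division of `Q ^ 2` by `1 - X` leaves a factor that vanishes only at `r ^ 2`. -/
lemma bddCoeff_one_sub_X_mul_derivative2 :
    BddCoeff ((1 - X) * d⁄dX ℝ (d⁄dX ℝ discSeries)) := by
  set L : ℝ⟦X⟧ := C (-(1 + r⁻¹ ^ 2)) + C (2 * r⁻¹ ^ 2) * X with hLdef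
  have hL : SummableCoeff L := (SummableCoeff.C _).add (SummableCoeff.X.C_mul _)
  have h2 : (C (1 / 2) : ℝ⟦X⟧) * 2 = 1 := by
    rw [← map_ofNat (C (R := ℝ)) 2, ← map_mul]
    norm_num
  have h1 := two_mul_discSeries_mul_derivative
  have h3 := discSeries_second
  have h5 := discSeries_sq
  have h6 := geometric_r
  rw [← hLdef] at h1
  set D := d⁄dX ℝ discSeries
  set D2 := d⁄dX ℝ D
  set G := rescale (r⁻¹ ^ 2) (mk 1 : ℝ⟦X⟧)
  set c2 : ℝ⟦X⟧ := C (2 * r⁻¹ ^ 2)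
  have he : (1 - X) * D2 = C (1 / 2) * ((discSeries * c2 - D * L) * G) := by
    have h7 : 2 * ((1 - X) * (1 - C (r⁻¹ ^ 2) * X) * D2) = discSeries * c2 - D * L := by
      rw [← h5]
      linear_combination discSeries * h3 - D * h1
    rw [← h7]
    linear_combination (-(1 - X) * D2) * h2 - C (1 / 2) * 2 * (1 - X) * D2 * h6
  rw [he]
  exact (((bddCoeff_discSeries.mul (SummableCoeff.C _)).sub
    (bddCoeff_derivative_discSeries.mul hL)).mul summableCoeff_geometric_r).C_mul _

lemma BddCoeff.of_C_mul {p : ℝ⟦X⟧} {b : ℝ} (hb : b ≠ 0) (h : BddCoeff (C b * p)) :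
    BddCoeff p := by
  have := h.C_mul b⁻¹
  rwa [← mul_assoc, ← map_mul, inv_mul_cancel₀ hb, map_one, one_mul] at this

lemma C_mul_derivative_normSeries :
    C (4 * s) * d⁄dX ℝ normSeries = -(C r⁻¹ + d⁄dX ℝ discSeries) := by
  rw [← derivative_C_mul, C_mul_normSeries, map_sub, map_sub, derivative_one, derivative_C_mul,
    derivative_X]
  ring

lemma bddCoeff_derivative_normSeries_sq : BddCoeff ((d⁄dX ℝ normSeries) ^ 2) := by
  have hs := s_pos
  refine BddCoeff.of_C_mul (b := (4 * s) ^ 2) (by positivity) ?_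
  have he : C ((4 * s) ^ 2) * (d⁄dX ℝ normSeries) ^ 2 =
      C (r⁻¹ ^ 2) + C (2 * r⁻¹) * d⁄dX ℝ discSeries + (d⁄dX ℝ discSeries) ^ 2 := by
    rw [map_pow, ← mul_pow, C_mul_derivative_normSeries]
    simp only [map_mul, map_pow, map_ofNat]
    ring
  rw [he]
  exact ((SummableCoeff.C _).bddCoeff.add (bddCoeff_derivative_discSeries.C_mul _)).add
    bddCoeff_derivative_discSeries_sq

/-- The second derivative of `normSeries` grows like `(1 - x) ^ (-3/2)` at `1`, where `normSeries`
takes the value `1` with a square root singularity, so that the product has order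
`(1 - x) ^ (-1)`. -/
lemma bddCoeff_derivative2_mul_one_sub :
    BddCoeff (d⁄dX ℝ (d⁄dX ℝ normSeries) * (1 - normSeries)) := by
  have hs := s_pos
  refine BddCoeff.of_C_mul (b := (4 * s) ^ 2) (by positivity) ?_
  have h1 : C (4 * s) * d⁄dX ℝ (d⁄dX ℝ normSeries) = -d⁄dX ℝ (d⁄dX ℝ discSeries) := by
    rw [← derivative_C_mul, C_mul_derivative_normSeries, map_neg, map_add, derivative_C, zero_add]
  have h2 : C (4 * s) * (1 - normSeries) = discSeries - C r⁻¹ * (1 - X) := by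
    rw [mul_sub, C_mul_normSeries, four_s, map_sub, map_one]
    ring
  have he : C ((4 * s) ^ 2) * (d⁄dX ℝ (d⁄dX ℝ normSeries) * (1 - normSeries)) =
      C r⁻¹ * ((1 - X) * d⁄dX ℝ (d⁄dX ℝ discSeries)) -
        discSeries * d⁄dX ℝ (d⁄dX ℝ discSeries) := by
    rw [map_pow]
    linear_combination (C (4 * s) * (1 - normSeries)) * h1 - d⁄dX ℝ (d⁄dX ℝ discSeries) * h2
  rw [he]
  exact (bddCoeff_one_sub_X_mul_derivative2.C_mul _).sub bddCoeff_discSeries_mul_derivative2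

/-- Multiplication by a power of `normSeries`, whose coefficients are nonnegative with sum at most
`1`, does not increase the maximum of the coefficients. -/
lemma abs_coeff_mul_normSeries_pow_le {p : ℝ⟦X⟧} {B : ℝ} (h : ∀ n, |coeff n p| ≤ B) (i n : ℕ) :
    |coeff n (p * normSeries ^ i)| ≤ B := by
  have hB : 0 ≤ B := (abs_nonneg _).trans (h 0)
  induction i generalizing n with
  | zero => simpa using h n
  | succ i ih =>
    rw [pow_succ, ← mul_assoc]
    refine (abs_coeff_mul_le hB ih (K := 1) (fun N => ?_) n).trans_eq (mul_one B)
    refine le_trans (le_of_eq ?_) (sum_coeff_normSeries_le_one N)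
    refine Finset.sum_congr rfl fun n _ => abs_of_nonneg ?_
    simpa using coeff_normSeries_pow_nonneg n 1

/-- The second derivative of the error in the linear approximation
`V ^ (j + 1) ≈ 1 + (j + 1) (V - 1)` of the powers of `V = normSeries`. -/
lemma derivative2_normSeries_pow (j : ℕ) :
    d⁄dX ℝ (d⁄dX ℝ (normSeries ^ (j + 1) - C ((j : ℝ) + 1) * normSeries)) =
      C ((j : ℝ) + 1) * (C (j : ℝ) * ((d⁄dX ℝ normSeries) ^ 2 * normSeries ^ (j - 1)) -
        ∑ i ∈ Finset.range j,
          d⁄dX ℝ (d⁄dX ℝ normSeries) * (1 - normSeries) * normSeries ^ i) := by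
  have hn : ∀ n : ℕ, ((n : ℕ) : ℝ⟦X⟧) = C (n : ℝ) := fun n => (map_natCast C n).symm
  have h1 : d⁄dX ℝ (normSeries ^ (j + 1) - C ((j : ℝ) + 1) * normSeries) =
      C ((j : ℝ) + 1) * ((normSeries ^ j - 1) * d⁄dX ℝ normSeries) := by
    rw [map_sub, derivative_pow, derivative_C_mul, hn, Nat.add_sub_cancel]
    push_cast
    ring
  rw [h1, derivative_C_mul, Derivation.leibniz, map_sub, derivative_pow, derivative_one, hn,
    smul_eq_mul, smul_eq_mul, ← geom_sum_mul, Finset.sum_mul, Finset.sum_mul, ← Finset.mul_sum]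
  rw [← Finset.sum_mul, ← Finset.sum_mul]
  ring

/-- The coefficients of the `j`-th power are `j` times those of `normSeries`, up to
`O(j ^ 2 / n ^ 2)`, uniformly in `j`. -/
lemma coeff_normSeries_pow_sub : ∃ B : ℝ, ∀ m j : ℕ,
    |coeff (m + 1) (normSeries ^ (j + 1)) - (j + 1 : ℕ) * coeff (m + 1) normSeries| ≤
      B * ((j + 1 : ℕ) : ℝ) ^ 2 / ((m + 1 : ℕ) : ℝ) ^ 2 := by
  obtain ⟨B₁, h10, h1⟩ := bddCoeff_derivative_normSeries_sq.nonneg_bound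
  obtain ⟨B₂, h20, h2⟩ := bddCoeff_derivative2_mul_one_sub.nonneg_bound
  refine ⟨2 * (B₁ + B₂) + 2, fun m j => ?_⟩
  have hj : (0 : ℝ) ≤ j := j.cast_nonneg
  have h3 : ∀ n, |coeff n (d⁄dX ℝ (d⁄dX ℝ (normSeries ^ (j + 1) -
      C ((j : ℝ) + 1) * normSeries)))| ≤ (B₁ + B₂) * ((j + 1 : ℕ) : ℝ) ^ 2 := by
    intro n
    rw [derivative2_normSeries_pow, coeff_C_mul, map_sub, coeff_C_mul, map_sum, abs_mul,
      abs_of_nonneg (by positivity : (0 : ℝ) ≤ j + 1)]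
    have h4 := abs_coeff_mul_normSeries_pow_le h1 (j - 1) n
    have h5 : |∑ i ∈ Finset.range j, coeff n
        (d⁄dX ℝ (d⁄dX ℝ normSeries) * (1 - normSeries) * normSeries ^ i)| ≤ j * B₂ := by
      refine (Finset.abs_sum_le_sum_abs _ _).trans ?_
      refine (Finset.sum_le_card_nsmul _ _ B₂ fun i _ =>
        abs_coeff_mul_normSeries_pow_le h2 i n).trans_eq ?_
      simp
    have h6 := abs_sub ((j : ℝ) * coeff n ((d⁄dX ℝ normSeries) ^ 2 * normSeries ^ (j - 1)))
      (∑ i ∈ Finset.range j, coeff n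
        (d⁄dX ℝ (d⁄dX ℝ normSeries) * (1 - normSeries) * normSeries ^ i))
    rw [abs_mul, abs_of_nonneg hj] at h6
    have h7 : (j : ℝ) * |coeff n ((d⁄dX ℝ normSeries) ^ 2 * normSeries ^ (j - 1))| ≤ j * B₁ := by
      gcongr
    have h8 := h6.trans (add_le_add h7 h5)
    calc _ ≤ ((j : ℝ) + 1) * (j * B₁ + j * B₂) := by gcongr
      _ ≤ _ := by push_cast; nlinarith [mul_nonneg hj h10, mul_nonneg hj h20]
  have hone : ∀ n, |coeff n (1 : ℝ⟦X⟧)| ≤ 1 := fun n => by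
    rw [coeff_one]; split_ifs <;> simp
  have h4 : |coeff 1 (normSeries ^ (j + 1) - C ((j : ℝ) + 1) * normSeries)| ≤
      2 * ((j + 1 : ℕ) : ℝ) ^ 2 := by
    have h5 := abs_coeff_mul_normSeries_pow_le hone (j + 1) 1
    have h6 := abs_coeff_mul_normSeries_pow_le hone 1 1
    rw [one_mul] at h5 h6
    rw [pow_one] at h6
    rw [map_sub, coeff_C_mul]
    refine (abs_sub _ _).trans ?_
    rw [abs_mul, abs_of_nonneg (by positivity : (0 : ℝ) ≤ j + 1)]
    push_cast
    nlinarith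
  have h9 := abs_coeff_succ_le_of_derivative2 h3 h4 m
  rw [map_sub, coeff_C_mul] at h9
  push_cast at h9 ⊢
  refine h9.trans (le_of_eq ?_)
  ring

/-! ### Bounds for the tree counts -/

lemma rpow_neg_three_halves {a : ℝ} (ha : 0 < a) : a ^ (-3 / 2 : ℝ) = (a * √a)⁻¹ := by
  rw [show (-3 / 2 : ℝ) = -(1 + 1 / 2) by norm_num, Real.rpow_neg ha.le,
    Real.rpow_add ha, Real.rpow_one, Real.sqrt_eq_rpow]

lemma rpow_neg_three_halves_sub_succ {a : ℝ} (ha : 1 ≤ a) :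
    |a ^ (-3 / 2 : ℝ) - (a + 1) ^ (-3 / 2 : ℝ)| ≤ 3 / (a + 1) ^ 2 := by
  have ha0 : 0 < a := by linarith
  have hle : (a + 1) ^ (-3 / 2 : ℝ) ≤ a ^ (-3 / 2 : ℝ) :=
    Real.rpow_le_rpow_of_nonpos ha0 (by linarith) (by norm_num)
  rw [abs_of_nonneg (by linarith), rpow_neg_three_halves ha0,
    rpow_neg_three_halves (by linarith)]
  have h1 : 1 ≤ √a := Real.one_le_sqrt.2 ha
  have h2 : √(a + 1) * a ≤ √a * (a + 1) := by
    have e1 : √(a + 1) * a = √(a * (a * (a + 1))) := by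
      rw [← mul_assoc, Real.sqrt_mul (by positivity), Real.sqrt_mul_self ha0.le, mul_comm]
    have e2 : √a * (a + 1) = √(a * ((a + 1) * (a + 1))) := by
      rw [Real.sqrt_mul ha0.le, Real.sqrt_mul_self (by linarith)]
    rw [e1, e2]
    apply Real.sqrt_le_sqrt
    gcongr
    linarith
  have h3 : a / ((a + 1) ^ 2 * √a) ≤ ((a + 1) * √(a + 1))⁻¹ := by
    rw [inv_eq_one_div, div_le_div_iff₀ (by positivity) (by positivity)]
    calc a * ((a + 1) * √(a + 1)) = (a + 1) * (√(a + 1) * a) := by ring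
      _ ≤ (a + 1) * (√a * (a + 1)) := by gcongr
      _ = _ := by ring
  have h4 : (a * √a)⁻¹ - a / ((a + 1) ^ 2 * √a) ≤ 3 / (a + 1) ^ 2 := by
    have : (a * √a)⁻¹ - a / ((a + 1) ^ 2 * √a) = (2 * a + 1) / (a * √a) / (a + 1) ^ 2 := by
      field_simp
      ring
    rw [this]
    gcongr
    rw [div_le_iff₀ (by positivity)]
    nlinarith
  linarith

/-- The constant in the asymptotics of the coefficients of `normSeries`. -/
noncomputable def coeffConst : ℝ := sqrtAtOne / (8 * s * √Real.pi)

lemma coeffConst_pos : 0 < coeffConst := by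
  have := sqrtAtOne_pos
  have := s_pos
  have := Real.sqrt_pos.2 Real.pi_pos
  unfold coeffConst
  positivity

lemma two_mul_s_mul_coeffConst : 2 * s * coeffConst = q * s ^ 2 / √Real.pi := by
  have h1 := q_div_r
  rw [div_eq_mul_inv, r_inv] at h1
  have := s_pos
  have := Real.sqrt_pos.2 Real.pi_pos
  rw [coeffConst, sqrtAtOne, r_inv, h1]
  field_simp
  ring

/-- The coefficients of the powers, expressed in `n = m + 2` and `k = j + 2`, the parameters of the
corresponding trees. -/
lemma coeff_normSeries_pow_asymp : ∃ B : ℝ, 0 ≤ B ∧ ∀ m j : ℕ,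
    |coeff (m + 1) (normSeries ^ (j + 1)) -
      coeffConst * ((m + 2 : ℕ) : ℝ) ^ (-3 / 2 : ℝ) * ((j + 2 : ℕ) : ℝ)| ≤
      coeffConst * ((m + 2 : ℕ) : ℝ) ^ (-3 / 2 : ℝ) +
        B * ((j + 2 : ℕ) : ℝ) ^ 2 / ((m + 2 : ℕ) : ℝ) ^ 2 := by
  obtain ⟨B₁, h1⟩ := coeff_normSeries_pow_sub
  obtain ⟨B₂, h2⟩ := coeff_normSeries_asymp
  have hA := coeffConst_pos
  refine ⟨4 * |B₁| + 4 * |B₂| + 3 * coeffConst, by positivity, fun m j => ?_⟩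
  have h3 := h1 m j
  have h4 := h2 m
  rw [← coeffConst] at h4
  have h5 := rpow_neg_three_halves_sub_succ (a := ((m + 1 : ℕ) : ℝ))
    (by push_cast; linarith [m.cast_nonneg (α := ℝ)])
  have e1 : ((m + 1 : ℕ) : ℝ) + 1 = ((m + 2 : ℕ) : ℝ) := by push_cast; ring
  have e2 : ((j + 1 : ℕ) : ℝ) + 1 = ((j + 2 : ℕ) : ℝ) := by push_cast; ring
  rw [e1] at h5
  set a := ((m + 1 : ℕ) : ℝ)
  set b := ((m + 2 : ℕ) : ℝ)
  set J := ((j + 1 : ℕ) : ℝ) with hJ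
  set k := ((j + 2 : ℕ) : ℝ)
  have hJ1 : 1 ≤ J := by rw [hJ]; push_cast; linarith [j.cast_nonneg (α := ℝ)]
  have ha1 : 1 ≤ a := by simp [a]
  have hinv : 1 / a ^ 2 ≤ 4 / b ^ 2 := by
    rw [div_le_div_iff₀ (by positivity) (by nlinarith)]
    nlinarith
  have hb : 0 < b := by linarith
  set v := coeff (m + 1) (normSeries ^ (j + 1))
  set v1 := coeff (m + 1) normSeries
  set α := a ^ (-3 / 2 : ℝ)
  set β := b ^ (-3 / 2 : ℝ)
  have hβ : 0 ≤ β := by positivity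
  have e3 : v - coeffConst * β * k = (v - J * v1) + J * (v1 - coeffConst * α) +
      J * coeffConst * (α - β) - coeffConst * β := by rw [← e2]; ring
  have h6 : |J * (v1 - coeffConst * α)| ≤ 4 * |B₂| * k ^ 2 / b ^ 2 := by
    rw [abs_mul, abs_of_nonneg (by linarith : 0 ≤ J)]
    calc _ ≤ k ^ 2 * (B₂ / a ^ 2) := by gcongr; nlinarith
      _ ≤ k ^ 2 * (|B₂| * (1 / a ^ 2)) := by
        rw [mul_one_div]; gcongr; exact le_abs_self _
      _ ≤ k ^ 2 * (|B₂| * (4 / b ^ 2)) := by gcongr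
      _ = _ := by ring
  have h7 : |J * coeffConst * (α - β)| ≤ 3 * coeffConst * k ^ 2 / b ^ 2 := by
    rw [abs_mul, abs_of_nonneg (by positivity : 0 ≤ J * coeffConst)]
    calc _ ≤ k ^ 2 * coeffConst * (3 / b ^ 2) := by gcongr; nlinarith
      _ = _ := by ring
  have h8 : |v - J * v1| ≤ 4 * |B₁| * k ^ 2 / b ^ 2 := by
    calc _ ≤ B₁ * J ^ 2 / a ^ 2 := h3
      _ ≤ |B₁| * k ^ 2 / a ^ 2 := by
        gcongr
        · exact le_abs_self _
        · linarith
      _ = |B₁| * k ^ 2 * (1 / a ^ 2) := by ring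
      _ ≤ |B₁| * k ^ 2 * (4 / b ^ 2) := by gcongr
      _ = _ := by ring
  rw [e3]
  calc _ ≤ |v - J * v1| + |J * (v1 - coeffConst * α)| + |J * coeffConst * (α - β)| +
        |coeffConst * β| :=
      (abs_sub _ _).trans (add_le_add (abs_add_three _ _ _) le_rfl)
    _ ≤ 4 * |B₁| * k ^ 2 / b ^ 2 + 4 * |B₂| * k ^ 2 / b ^ 2 + 3 * coeffConst * k ^ 2 / b ^ 2 +
        coeffConst * β := by
      gcongr
      rw [abs_of_nonneg (by positivity)]
    _ = _ := by ring

lemma r_rpow_sub (m j : ℕ) : r ^ (m + 1) * (2 * s) ^ (j + 1) =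
    2 * s * r ^ (((m + 2 : ℕ) : ℝ) - ((j + 2 : ℕ) : ℝ) / 2) := by
  have hs := s_pos
  have h1 : 2 * s = r ^ (-(1 / 2) : ℝ) := by
    rw [Real.rpow_neg r_pos.le, ← Real.sqrt_eq_rpow, sqrt_r, inv_inv]
  rw [h1, ← Real.rpow_natCast (r ^ (-(1 / 2) : ℝ)), ← Real.rpow_mul r_pos.le,
    ← Real.rpow_natCast, ← Real.rpow_add r_pos, ← Real.rpow_add r_pos]
  congr 1
  push_cast
  ring

theorem treeCount_le (p : ℝ) (hp : 0 < p) (hpr : p < r ^ (1 / 2 : ℝ)) :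
    ∃ M : ℝ, 0 < M ∧ ∀ n k : ℕ, 2 ≤ n → 2 ≤ k →
      (treeCount n k : ℝ) ≤ M * r ^ n * (n : ℝ) ^ (-3 / 2 : ℝ) * p ^ (-(k : ℤ)) := by
  obtain ⟨B, hB, h⟩ := coeff_normSeries_pow_asymp
  have hA := coeffConst_pos
  have hs := s_pos
  have hr := r_pos
  rw [← Real.sqrt_eq_rpow, sqrt_r, ← one_div, lt_div_iff₀ (by positivity)] at hpr
  -- `k ^ 2 (2 s) ^ k` is bounded by a multiple of `p ^ (-k)`, as `2 s p < 1`
  have hsum := summable_pow_mul_geometric_of_norm_lt_one 2 (r := p * (2 * s))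
    (by rwa [Real.norm_of_nonneg (by positivity)])
  set K := ∑' n : ℕ, (n : ℝ) ^ 2 * (p * (2 * s)) ^ n
  have hK : ∀ k : ℕ, (k : ℝ) ^ 2 * (p * (2 * s)) ^ k ≤ K := fun k =>
    hsum.le_tsum k fun _ _ => by positivity
  have hK0 : 0 < K := lt_of_lt_of_le (by positivity) (hK 1)
  refine ⟨(2 * coeffConst + B) * K * (2 * s)⁻¹, by positivity, fun n k hn hk => ?_⟩
  obtain ⟨m, rfl⟩ := Nat.exists_eq_add_of_le' hn
  obtain ⟨j, rfl⟩ := Nat.exists_eq_add_of_le' hk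
  rw [treeCount_eq]
  have h1 := h m j
  have hKj := hK (j + 2)
  set v := coeff (m + 1) (normSeries ^ (j + 1))
  set b := ((m + 2 : ℕ) : ℝ) with hb
  set x := ((j + 2 : ℕ) : ℝ) with hx
  have hb1 : 1 ≤ b := by rw [hb]; push_cast; linarith [m.cast_nonneg (α := ℝ)]
  have hx1 : 1 ≤ x := by rw [hx]; push_cast; linarith [j.cast_nonneg (α := ℝ)]
  have hb2 : (b ^ 2)⁻¹ ≤ b ^ (-3 / 2 : ℝ) := by
    rw [← Real.rpow_natCast, ← Real.rpow_neg (by linarith)]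
    exact Real.rpow_le_rpow_of_exponent_le hb1 (by norm_num)
  set β := b ^ (-3 / 2 : ℝ)
  have hβ : 0 ≤ β := by positivity
  have h2 : v ≤ (2 * coeffConst + B) * β * x ^ 2 := by
    have h3 := (abs_le.1 h1).2
    have h4 : B * x ^ 2 / b ^ 2 ≤ B * x ^ 2 * β := by rw [div_eq_mul_inv]; gcongr
    have h5 : coeffConst * β * x ≤ coeffConst * β * x ^ 2 := by gcongr; nlinarith
    have h6 : coeffConst * β * 1 ≤ coeffConst * β * x ^ 2 := by gcongr; nlinarith
    linarith
  have hrn : r ^ (m + 1) ≤ r ^ (m + 2) := pow_le_pow_right₀ one_lt_r.le (by omega)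
  have h7 : (2 * s) ^ (j + 2) * x ^ 2 ≤ K * (p ^ (j + 2))⁻¹ := by
    rw [← div_eq_mul_inv, le_div_iff₀ (by positivity)]
    calc _ = x ^ 2 * (p * (2 * s)) ^ (j + 2) := by rw [mul_pow]; ring
      _ ≤ K := hKj
  have hv : 0 ≤ v := coeff_normSeries_pow_nonneg _ _
  rw [zpow_neg, zpow_natCast]
  calc r ^ (m + 1) * (2 * s) ^ (j + 1) * v
      ≤ r ^ (m + 2) * (2 * s) ^ (j + 1) * ((2 * coeffConst + B) * β * x ^ 2) := by gcongr
    _ = (2 * coeffConst + B) * (2 * s)⁻¹ * r ^ (m + 2) * β * ((2 * s) ^ (j + 2) * x ^ 2) := by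
      rw [pow_succ (2 * s) (j + 1)]
      field_simp
    _ ≤ (2 * coeffConst + B) * (2 * s)⁻¹ * r ^ (m + 2) * β * (K * (p ^ (j + 2))⁻¹) := by gcongr
    _ = _ := by ring

theorem treeCount_asymp (L : ℝ) (hL : 0 < L) :
    ∃ M : ℝ, 0 < M ∧ ∃ k₀ : ℕ, ∀ n k : ℕ, 2 ≤ n → 2 ≤ k → k₀ ≤ k →
      (k : ℝ) ≤ L * Real.log n →
      |(treeCount n k : ℝ) - q * s ^ 2 / √Real.pi * r ^ ((n : ℝ) - (k : ℝ) / 2) *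
          (n : ℝ) ^ (-3 / 2 : ℝ) * (k : ℝ)| ≤
        M * r ^ ((n : ℝ) - (k : ℝ) / 2) * (n : ℝ) ^ (-3 / 2 : ℝ) := by
  obtain ⟨B, hB, h⟩ := coeff_normSeries_pow_asymp
  have hA := coeffConst_pos
  have hs := s_pos
  refine ⟨2 * s * (coeffConst + B * (4 * L) ^ 2), by positivity, 0, fun n k hn hk _ hkn => ?_⟩
  obtain ⟨m, rfl⟩ := Nat.exists_eq_add_of_le' hn
  obtain ⟨j, rfl⟩ := Nat.exists_eq_add_of_le' hk
  rw [treeCount_eq, r_rpow_sub, ← two_mul_s_mul_coeffConst]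
  have h1 := h m j
  set v := coeff (m + 1) (normSeries ^ (j + 1))
  set R := r ^ (((m + 2 : ℕ) : ℝ) - ((j + 2 : ℕ) : ℝ) / 2)
  have hR : 0 < R := Real.rpow_pos_of_pos r_pos _
  set b := ((m + 2 : ℕ) : ℝ) with hb
  set x := ((j + 2 : ℕ) : ℝ) with hx
  have hb1 : 1 ≤ b := by rw [hb]; push_cast; linarith [m.cast_nonneg (α := ℝ)]
  have hx0 : 0 ≤ x := by positivity
  -- `k ≤ L log n ≤ 4 L n ^ (1/4)`, so `k ^ 2 / n ^ 2` is `O(n ^ (-3/2))`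
  have h2 : x ^ 2 / b ^ 2 ≤ (4 * L) ^ 2 * b ^ (-3 / 2 : ℝ) := by
    have h3 := Real.log_le_rpow_div (x := b) (by linarith) (show (0 : ℝ) < 1 / 4 by norm_num)
    have h4 : x ≤ 4 * L * b ^ (1 / 4 : ℝ) := by
      calc x ≤ L * Real.log b := hkn
        _ ≤ L * (b ^ (1 / 4 : ℝ) / (1 / 4)) := by gcongr
        _ = _ := by ring
    have h5 : b ^ (-3 / 2 : ℝ) = (b ^ (1 / 4 : ℝ)) ^ 2 / b ^ 2 := by
      rw [← Real.rpow_natCast, ← Real.rpow_natCast, ← Real.rpow_mul (by linarith),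
        ← Real.rpow_sub (by linarith)]
      norm_num
    rw [h5, ← mul_div_assoc, ← mul_pow]
    gcongr
  calc |2 * s * R * v - 2 * s * coeffConst * R * b ^ (-3 / 2 : ℝ) * x|
      = 2 * s * R * |v - coeffConst * b ^ (-3 / 2 : ℝ) * x| := by
        rw [← abs_of_pos (by positivity : 0 < 2 * s * R), ← abs_mul,
          abs_of_pos (by positivity : 0 < 2 * s * R)]
        congr 1
        ring
    _ ≤ 2 * s * R * (coeffConst * b ^ (-3 / 2 : ℝ) + B * x ^ 2 / b ^ 2) := by gcongr
    _ = 2 * s * R * (coeffConst * b ^ (-3 / 2 : ℝ) + B * (x ^ 2 / b ^ 2)) := by ring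
    _ ≤ 2 * s * R * (coeffConst * b ^ (-3 / 2 : ℝ) + B * ((4 * L) ^ 2 * b ^ (-3 / 2 : ℝ))) := by
        gcongr
    _ = _ := by ring

/-! ### The double series -/

lemma coeff_zero_normSeries_pow_succ (j : ℕ) : coeff 0 (normSeries ^ (j + 1)) = 0 := by
  have := coeff_zero_normSeries
  rw [coeff_zero_eq_constantCoeff_apply] at this ⊢
  rw [map_pow, this, zero_pow (by omega)]

lemma scaledCoeff_eq (m j : ℕ) :
    scaledCoeff (m + 1) (j + 2) = ((2 * s * coeff m (normSeries ^ (j + 1)) : ℝ) : ℂ) := by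
  have hs := s_pos
  have hr := r_pos
  cases m with
  | zero => simp [scaledCoeff, treeCount, -coeff_zero_eq_constantCoeff,
      coeff_zero_normSeries_pow_succ]
  | succ m =>
    rw [scaledCoeff]
    have h : ((treeCount (m + 2) (j + 2) : ℝ)) / (r ^ (m + 2) * (2 * s) ^ (j + 2)) =
        2 * s * coeff (m + 1) (normSeries ^ (j + 1)) := by
      rw [treeCount_eq, div_eq_iff (by positivity)]
      linear_combination (-(r ^ (m + 1) * (2 * s) ^ (j + 1) *
        coeff (m + 1) (normSeries ^ (j + 1)))) * r_mul_sq_s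
    rw [← h]
    push_cast
    rfl

/-- The function represented by the rescaled generating function of the tree counts. -/
noncomputable def genFun (z : ℂ × ℂ) : ℂ :=
  (2 * s : ℝ) * z.1 * z.2 * ((z.2 * normFun z.1) / (1 - z.2 * normFun z.1))

/-- Summation over the second index gives the powers of `y * normFun x`, summation over the first
one a geometric series. -/
lemma hasSum_normSeries_pow {x y : ℂ} (hx : ‖x‖ < 1) (hy : ‖y‖ < 1) :
    HasSum (fun i : ℕ × ℕ =>
      ((coeff i.2 (normSeries ^ (i.1 + 1)) : ℝ) : ℂ) * x ^ i.2 * y ^ (i.1 + 1))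
      ((y * normFun x) / (1 - y * normFun x)) := by
  have hX : ‖((‖x‖ : ℝ) : ℂ)‖ < 1 := by simpa using hx
  have hb : ∀ j : ℕ, Summable (fun m => coeff m (normSeries ^ j) * ‖x‖ ^ m) ∧
      ∑' m, coeff m (normSeries ^ j) * ‖x‖ ^ m ≤ 1 := by
    intro j
    have h1 := Complex.hasSum_re ((absHasSum_normSeries hX).pow j).2
    simp only [← Complex.ofReal_pow, ← Complex.ofReal_mul, Complex.ofReal_re] at h1
    refine ⟨h1.summable, h1.tsum_eq.le.trans ((Complex.re_le_norm _).trans ?_)⟩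
    rw [norm_pow]
    refine pow_le_one₀ (norm_nonneg _) (norm_normFun_lt_one hX.le ?_).le
    rintro h
    rw [h, norm_one] at hX
    exact lt_irrefl _ hX
  have hnorm : ∀ j m : ℕ,
      ‖((coeff m (normSeries ^ (j + 1)) : ℝ) : ℂ) * x ^ m * y ^ (j + 1)‖ =
      coeff m (normSeries ^ (j + 1)) * ‖x‖ ^ m * ‖y‖ ^ (j + 1) := by
    intro j m
    rw [norm_mul, norm_mul, norm_pow, norm_pow, Complex.norm_real,
      Real.norm_of_nonneg (coeff_normSeries_pow_nonneg _ _)]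
  have hsum : Summable (fun i : ℕ × ℕ =>
      ((coeff i.2 (normSeries ^ (i.1 + 1)) : ℝ) : ℂ) * x ^ i.2 * y ^ (i.1 + 1)) := by
    refine Summable.of_norm ?_
    have hgeom : Summable fun j : ℕ => ‖y‖ ^ (j + 1) :=
      (summable_nat_add_iff (f := fun j => ‖y‖ ^ j) 1).2
        (summable_geometric_of_lt_one (norm_nonneg y) hy)
    refine (summable_prod_of_nonneg fun i => norm_nonneg _).2 ⟨fun j => ?_, ?_⟩
    · simp only [hnorm]
      exact (hb (j + 1)).1.mul_right (‖y‖ ^ (j + 1))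
    · refine Summable.of_nonneg_of_le (fun j => tsum_nonneg fun m => norm_nonneg _) (fun j => ?_)
        hgeom
      simp only [hnorm]
      rw [tsum_mul_right]
      exact mul_le_of_le_one_left (by positivity) (hb (j + 1)).2
  have h2 := hsum.hasSum.prod_fiberwise fun j =>
    ((absHasSum_normSeries hx).pow (j + 1)).2.mul_right (y ^ (j + 1))
  have hv : ‖normFun x‖ < 1 := norm_normFun_lt_one hx.le (by rintro rfl; simp at hx)
  have hyv : ‖y * normFun x‖ < 1 := by
    rw [norm_mul]
    nlinarith [norm_nonneg y, norm_nonneg (normFun x)]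
  have h3 := (hasSum_geometric_of_norm_lt_one hyv).mul_left (y * normFun x)
  have h4 : ∀ j : ℕ, normFun x ^ (j + 1) * y ^ (j + 1) =
      y * normFun x * (y * normFun x) ^ j := fun j => by ring
  simp only [h4] at h2
  have h5 := hsum.hasSum
  rwa [h2.unique h3, ← div_eq_mul_inv] at h5

lemma hasSum_genFun {x y : ℂ} (hx : ‖x‖ < 1) (hy : ‖y‖ < 1) :
    HasSum (fun i : ℕ × ℕ => scaledCoeff i.1 i.2 * x ^ i.1 * y ^ i.2) (genFun (x, y)) := by
  have hinj : Function.Injective fun i : ℕ × ℕ => (i.2 + 1, i.1 + 2) := by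
    rintro ⟨a, b⟩ ⟨a', b'⟩ h
    simpa [and_comm] using h
  -- the tree counts vanish outside of the image of this map
  rw [← hinj.hasSum_iff]
  · have h := (hasSum_normSeries_pow hx hy).mul_left (((2 * s : ℝ) : ℂ) * x * y)
    refine h.congr_fun fun i => ?_
    simp only [Function.comp_apply, scaledCoeff_eq]
    push_cast
    ring
  · rintro ⟨n, k⟩ hnk
    have : treeCount n k = 0 := by
      rw [treeCount, if_neg]
      rintro ⟨h1, h2⟩
      exact hnk ⟨(k - 2, n - 1), by simp; omega⟩
    simp [scaledCoeff, this]

/-! ### The delta-domain -/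

lemma one_sub_mem_slitPlane_of_re {x : ℂ} (h1 : x ≠ 1) (h : (x - 1).re ≤ ‖x - 1‖ / 2) :
    1 - x ∈ Complex.slitPlane := by
  by_contra hx
  rw [Complex.mem_slitPlane_iff, not_or, not_lt, not_not] at hx
  have h2 : (x - 1).im = 0 := by simpa using hx.2
  have h3 : 0 ≤ (x - 1).re := by simpa using hx.1
  have h4 : ‖x - 1‖ = (x - 1).re := by
    rw [← Complex.abs_re_eq_norm.2 h2, abs_of_nonneg h3]
  have h5 : ‖x - 1‖ = 0 := by linarith [norm_nonneg (x - 1)]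
  exact h1 (sub_eq_zero.1 (norm_eq_zero.1 h5))

/-- The angle `π / 3` turns membership in a delta-domain into an algebraic condition. -/
lemma re_le_of_mem_deltaDomain {ε : ℝ} {x : ℂ} (hx : x ∈ deltaDomain ε (Real.pi / 3)) :
    (x - 1).re ≤ ‖x - 1‖ / 2 := by
  have h1 := Complex.norm_mul_cos_arg (x - 1)
  have h2 : Real.cos (Complex.arg (x - 1)) ≤ 1 / 2 := by
    rw [← Real.cos_abs, ← Real.cos_pi_div_three]
    exact Real.cos_le_cos_of_nonneg_of_le_pi (by positivity) (Complex.abs_arg_le_pi _) hx.2.2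
  rw [← h1]
  nlinarith [norm_nonneg (x - 1)]

lemma sqrtAtOne_sq : sqrtAtOne ^ 2 = 1 - r⁻¹ ^ 2 :=
  Real.sq_sqrt (by linarith [r_inv_sq_lt_one])

lemma four_s_mul_one_sub_normFun (x : ℂ) : (4 * s : ℝ) * (1 - normFun x) =
    sqrtOneSub x * sqrtOneSub ((r⁻¹ ^ 2 : ℝ) * x) - (r⁻¹ : ℝ) * sqrtOneSub x ^ 2 := by
  have h1 : ((4 * s : ℝ) : ℂ) * normFun x =
      1 - (r⁻¹ : ℝ) * x - sqrtOneSub x * sqrtOneSub ((r⁻¹ ^ 2 : ℝ) * x) := by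
    rw [normFun, ← mul_assoc, ← Complex.ofReal_mul, mul_inv_cancel₀ (by linarith [s_pos]),
      Complex.ofReal_one, one_mul]
  rw [mul_sub, h1, four_s, sqrtOneSub_sq]
  push_cast
  ring

/-- The square root `√(1 - x / r ^ 2)` differs from its value at `1` by `O(|1 - x|)`. -/
lemma norm_sqrtAtOne_sub_le (x : ℂ) :
    ‖(sqrtAtOne : ℂ) - sqrtOneSub ((r⁻¹ ^ 2 : ℝ) * x)‖ ≤ sqrtAtOne⁻¹ * ‖sqrtOneSub x‖ ^ 2 := by
  have hh := sqrtAtOne_pos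
  have ht := sqrtOneSub_re_nonneg ((r⁻¹ ^ 2 : ℝ) * x)
  have ht2 := sqrtOneSub_sq ((r⁻¹ ^ 2 : ℝ) * x)
  rw [norm_sqrtOneSub_sq]
  set t := sqrtOneSub ((r⁻¹ ^ 2 : ℝ) * x)
  have h1 : sqrtAtOne ≤ ‖(sqrtAtOne : ℂ) + t‖ := by
    refine le_trans ?_ (Complex.re_le_norm _)
    simpa using ht
  have h2 : ((sqrtAtOne : ℂ) - t) * (sqrtAtOne + t) = -((r⁻¹ ^ 2 : ℝ) * (1 - x)) := by
    have h3 : (sqrtAtOne : ℂ) ^ 2 = 1 - (r⁻¹ ^ 2 : ℝ) := by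
      rw [← Complex.ofReal_pow, sqrtAtOne_sq]; push_cast; ring
    linear_combination h3 - ht2
  have h4 := congrArg norm h2
  rw [norm_mul, norm_neg, norm_mul, Complex.norm_real, Real.norm_of_nonneg r_inv_sq_pos.le] at h4
  rw [← div_eq_inv_mul, le_div_iff₀ hh]
  calc _ ≤ ‖(sqrtAtOne : ℂ) - t‖ * ‖(sqrtAtOne : ℂ) + t‖ := by gcongr
    _ = r⁻¹ ^ 2 * ‖1 - x‖ := h4
    _ ≤ ‖1 - x‖ := mul_le_of_le_one_left (norm_nonneg _) r_inv_sq_lt_one.le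

/-- In the sector `1 - x` stays away from the negative axis, and its square root from the imaginary
axis. -/
lemma norm_sqrtOneSub_div_two_le {x : ℂ} (h : (x - 1).re ≤ ‖x - 1‖ / 2) :
    ‖sqrtOneSub x‖ / 2 ≤ (sqrtOneSub x).re := by
  have h0 := sqrtOneSub_re_nonneg x
  have h1 := norm_sqrtOneSub_sq x
  have h2 := congrArg Complex.re (sqrtOneSub_sq x)
  have h3 := Complex.sq_norm (sqrtOneSub x)
  rw [Complex.normSq_apply] at h3
  rw [sq, Complex.mul_re] at h2
  rw [norm_sub_rev x 1] at h
  simp only [Complex.sub_re, Complex.one_re] at h h2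
  refine abs_le_of_sq_le_sq' ?_ h0 |>.2
  nlinarith

/-- Near `1`, inside the sector, the linear term of `1 - normFun` in `√(1 - x)` has positive real
part and dominates, so that `normFun` has modulus less than `1`. -/
lemma exists_norm_normFun_lt_one_near : ∃ η : ℝ, 0 < η ∧ ∀ x : ℂ, x ≠ 1 →
    (x - 1).re ≤ ‖x - 1‖ / 2 → ‖x - 1‖ < η → ‖normFun x‖ < 1 := by
  have hh := sqrtAtOne_pos
  have hs := s_pos
  set h := sqrtAtOne
  set M := h + h⁻¹ + 1
  have hM : 0 < M := by positivity
  set N := M ^ 2 / (4 * s) + 2 * (h⁻¹ + 1)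
  have hN : 0 < N := by positivity
  refine ⟨(min 1 (h / N)) ^ 2, by positivity, fun x hx1 hre hη => ?_⟩
  have hw := norm_sqrtOneSub_div_two_le hre
  have hwx := norm_sqrtOneSub_sq x
  have ht := norm_sqrtAtOne_sub_le x
  have hu := four_s_mul_one_sub_normFun x
  rw [norm_sub_rev, ← hwx] at hη
  have hw0 : 0 < ‖sqrtOneSub x‖ := by
    refine norm_pos_iff.2 fun h0 => hx1 ?_
    have := sqrtOneSub_sq x
    rw [h0, zero_pow two_ne_zero] at this
    exact (sub_eq_zero.1 this.symm).symm
  have hη' := lt_of_pow_lt_pow_left₀ 2 (by positivity) hη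
  set w := sqrtOneSub x
  set t := sqrtOneSub ((r⁻¹ ^ 2 : ℝ) * x)
  have hw1 : ‖w‖ < 1 := hη'.trans_le (min_le_left _ _)
  have hw2 : ‖w‖ * N < h := by
    have := hη'.trans_le (min_le_right _ _)
    rwa [lt_div_iff₀ hN] at this
  have hr0 := r_inv_pos
  have hr1 := r_inv_lt_one
  -- the error of replacing `4 s (1 - normFun x)` by `h w`
  have herr : ‖(h : ℂ) * w - (4 * s : ℝ) * (1 - normFun x)‖ ≤ (h⁻¹ + 1) * ‖w‖ ^ 2 := by
    have e : (h : ℂ) * w - (4 * s : ℝ) * (1 - normFun x) = w * (h - t) + (r⁻¹ : ℝ) * w ^ 2 := by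
      rw [hu]; ring
    rw [e]
    refine (norm_add_le _ _).trans ?_
    rw [norm_mul, norm_mul, norm_pow, Complex.norm_real, Real.norm_of_nonneg hr0.le]
    have h1 : ‖w‖ * ‖(h : ℂ) - t‖ ≤ 1 * (h⁻¹ * ‖w‖ ^ 2) := by gcongr
    have h2 : r⁻¹ * ‖w‖ ^ 2 ≤ 1 * ‖w‖ ^ 2 := by gcongr
    linarith
  have hre1 : 4 * s * (1 - normFun x).re ≥ h * ‖w‖ / 2 - (h⁻¹ + 1) * ‖w‖ ^ 2 := by
    have h1 := (Complex.re_le_norm _).trans herr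
    rw [Complex.sub_re, Complex.re_ofReal_mul, Complex.re_ofReal_mul] at h1
    nlinarith
  have hn1 : 4 * s * ‖1 - normFun x‖ ≤ M * ‖w‖ := by
    have h1 := norm_sub_norm_le ((4 * s : ℝ) * (1 - normFun x)) ((h : ℂ) * w)
    rw [norm_sub_rev ((4 * s : ℝ) * (1 - normFun x))] at h1
    have h2 := h1.trans herr
    rw [norm_mul, norm_mul, Complex.norm_real, Complex.norm_real,
      Real.norm_of_nonneg (by positivity : 0 ≤ 4 * s), Real.norm_of_nonneg hh.le] at h2
    have h3 : (h⁻¹ + 1) * ‖w‖ ^ 2 ≤ (h⁻¹ + 1) * ‖w‖ := by gcongr; nlinarith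
    simp only [M]
    linarith
  set u := 1 - normFun x with hudef
  have hv : normFun x = 1 - u := by rw [hudef]; ring
  have h5 := Complex.sq_norm (1 - u)
  have h6 := Complex.sq_norm u
  rw [Complex.normSq_apply] at h5 h6
  simp only [Complex.sub_re, Complex.one_re, Complex.sub_im, Complex.one_im] at h5
  have h7 : ‖u‖ ^ 2 < 2 * u.re := by
    have h8 : (4 * s * ‖u‖) ^ 2 ≤ (M * ‖w‖) ^ 2 := by gcongr
    have h9 : M ^ 2 * ‖w‖ < 4 * s * (h - 2 * (h⁻¹ + 1) * ‖w‖) := by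
      have : ‖w‖ * N = (M ^ 2 * ‖w‖) / (4 * s) + 2 * (h⁻¹ + 1) * ‖w‖ := by
        simp only [N]; ring
      rw [this] at hw2
      have h10 : (M ^ 2 * ‖w‖) / (4 * s) < h - 2 * (h⁻¹ + 1) * ‖w‖ := by linarith
      rw [div_lt_iff₀ (by positivity)] at h10
      linarith
    have h11 := mul_lt_mul_of_pos_right h9 hw0
    have h12 : (4 * s) ^ 2 * ‖u‖ ^ 2 < (4 * s) ^ 2 * (2 * u.re) := by
      have h13 := mul_le_mul_of_nonneg_left hre1 (by positivity : 0 ≤ 2 * (4 * s))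
      nlinarith
    exact lt_of_mul_lt_mul_left h12 (by positivity)
  rw [hv]
  have h8 : ‖1 - u‖ ^ 2 < 1 := by nlinarith
  nlinarith [norm_nonneg (1 - u)]

lemma exists_norm_normFun_lt_one : ∃ ε : ℝ, 0 < ε ∧ ε ≤ 1 ∧
    ∀ x ∈ deltaDomain ε (Real.pi / 3), ‖normFun x‖ < 1 := by
  obtain ⟨η, hη, hnear⟩ := exists_norm_normFun_lt_one_near
  -- the points of the sector away from `1` at which the bound fails
  set K : Set ℂ := {x | ‖x‖ ≤ 2 ∧ η ≤ ‖x - 1‖ ∧ (x - 1).re ≤ ‖x - 1‖ / 2}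
  have hK : IsClosed K := by
    have h1 : Continuous fun x : ℂ => ‖x - 1‖ := by fun_prop
    have h2 : Continuous fun x : ℂ => (x - 1).re := Complex.continuous_re.comp (by fun_prop)
    exact (isClosed_le continuous_norm continuous_const).inter
      ((isClosed_le continuous_const h1).inter (isClosed_le h2 (h1.div_const 2)))
  have hcont : ContinuousOn (fun x => ‖normFun x‖) K := by
    intro x hx
    have h1 : x ≠ 1 := by
      rintro rfl
      have := hx.2.1
      rw [sub_self, norm_zero] at this
      linarith
    exact (analyticAt_normFun (one_sub_mem_slitPlane_of_re h1
      hx.2.2)).continuousAt.norm.continuousWithinAt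
  set K' := K ∩ (fun x => ‖normFun x‖) ⁻¹' Set.Ici 1
  have hK' : IsCompact K' := by
    refine Metric.isCompact_of_isClosed_isBounded
      (hcont.preimage_isClosed_of_isClosed hK isClosed_Ici) ?_
    refine (Metric.isBounded_closedBall (x := (0 : ℂ)) (r := 2)).subset fun x hx => ?_
    simpa using hx.1.1
  have hmain : ∀ ε, ε ≤ 1 → (∀ x ∈ K', 1 + ε < ‖x‖) →
      ∀ x ∈ deltaDomain ε (Real.pi / 3), ‖normFun x‖ < 1 := by
    intro ε hε h x hx
    have hre := re_le_of_mem_deltaDomain hx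
    by_cases hxη : ‖x - 1‖ < η
    · exact hnear x hx.2.1 hre hxη
    · by_contra! hge
      have := h x ⟨⟨by linarith [hx.1], not_lt.1 hxη, hre⟩, hge⟩
      linarith [hx.1]
  rcases K'.eq_empty_or_nonempty with he | hne
  · exact ⟨1, one_pos, le_rfl, hmain 1 le_rfl fun x hx => by simp [he] at hx⟩
  · obtain ⟨x₀, hx₀, hmin⟩ := hK'.exists_isMinOn hne continuous_norm.continuousOn
    have h1 : 1 < ‖x₀‖ := by
      by_contra! hle
      have h2 : x₀ ≠ 1 := by
        rintro rfl
        have := hx₀.1.2.1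
        rw [sub_self, norm_zero] at this
        linarith
      have h3 : 1 ≤ ‖normFun x₀‖ := hx₀.2
      linarith [norm_normFun_lt_one hle h2]
    refine ⟨min 1 ((‖x₀‖ - 1) / 2), lt_min one_pos (by linarith), min_le_left _ _,
      hmain _ (min_le_left _ _) fun x hx => ?_⟩
    have h4 : ‖x₀‖ ≤ ‖x‖ := hmin hx
    have h5 := min_le_right 1 ((‖x₀‖ - 1) / 2)
    linarith

/-! ### The singular expansion -/

/-- The error term of the expansion of `genFun`. -/
noncomputable def errorFun (z : ℂ × ℂ) : ℂ :=
  genFun z - ((-2 * q * s ^ 2 : ℝ) : ℂ) * z.2 ^ 2 * sqrtOneSub z.1 * ((1 - z.2) ^ 2)⁻¹ -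
    (2 * s : ℝ) * z.2 ^ 2 / (1 - z.2) * z.1

lemma one_sub_ne_zero {y : ℂ} (hy : ‖y‖ < 1) : 1 - y ≠ 0 := by
  intro h
  rw [← sub_eq_zero.1 h, norm_one] at hy
  exact lt_irrefl _ hy

lemma one_sub_norm_le {y v : ℂ} (hv : ‖v‖ ≤ 1) : 1 - ‖y‖ ≤ ‖1 - y * v‖ := by
  have h := norm_sub_norm_le 1 (y * v)
  rw [norm_one, norm_mul] at h
  nlinarith [norm_nonneg y]

lemma analyticAt_genFun {z : ℂ × ℂ} (h1 : 1 - z.1 ∈ Complex.slitPlane)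
    (hv : ‖normFun z.1‖ < 1) (hy : ‖z.2‖ < 1) : AnalyticAt ℂ genFun z := by
  have h2 : AnalyticAt ℂ (fun z : ℂ × ℂ => normFun z.1) z :=
    AnalyticAt.fun_comp (g := normFun) (analyticAt_normFun h1) analyticAt_fst
  have h3 := analyticAt_snd (𝕜 := ℂ) (p := z)
  have h4 := analyticAt_fst (𝕜 := ℂ) (p := z)
  unfold genFun
  refine ((analyticAt_const.mul h4).mul h3).mul ((h3.mul h2).div
    (analyticAt_const.sub (h3.mul h2)) fun h => ?_)
  have h5 := one_sub_norm_le (y := z.2) hv.le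
  change 1 - z.2 * normFun z.1 = 0 at h
  rw [h, norm_zero] at h5
  linarith

lemma analyticAt_errorFun {z : ℂ × ℂ} (h1 : 1 - z.1 ∈ Complex.slitPlane)
    (hv : ‖normFun z.1‖ < 1) (hy : ‖z.2‖ < 1) : AnalyticAt ℂ errorFun z := by
  have h2 : AnalyticAt ℂ (fun z : ℂ × ℂ => sqrtOneSub z.1) z :=
    AnalyticAt.fun_comp (g := sqrtOneSub) (analyticAt_sqrtOneSub h1) analyticAt_fst
  have h3 := analyticAt_snd (𝕜 := ℂ) (p := z)
  have h4 := analyticAt_fst (𝕜 := ℂ) (p := z)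
  have h5 : AnalyticAt ℂ (fun z : ℂ × ℂ => 1 - z.2) z := analyticAt_const.sub h3
  have h6 := one_sub_ne_zero hy
  unfold errorFun
  exact ((analyticAt_genFun h1 hv hy).sub (((analyticAt_const.mul (h3.pow 2)).mul h2).mul
    ((h5.pow 2).inv (pow_ne_zero 2 h6)))).sub (((analyticAt_const.mul (h3.pow 2)).div h5 h6).mul h4)

/-- The error term, with the factor `|1 - x| = |√(1 - x)| ^ 2` visible: the first summand is the
error of replacing `x (1 - normFun x)` by its leading term `q s √(1 - x)`, the second one is the
remainder of the geometric expansion, where `1 - normFun x = O(√(1 - x))`. -/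
lemma errorFun_eq {x y : ℂ} (hy : 1 - y ≠ 0) (hv : 1 - y * normFun x ≠ 0) :
    errorFun (x, y) = (2 * s : ℝ) * y ^ 2 * (
      (sqrtOneSub x * ((sqrtAtOne : ℂ) - sqrtOneSub ((r⁻¹ ^ 2 : ℝ) * x)) +
        sqrtOneSub x ^ 3 * sqrtOneSub ((r⁻¹ ^ 2 : ℝ) * x) +
        x * (r⁻¹ : ℝ) * sqrtOneSub x ^ 2) / ((4 * s : ℝ) * (1 - y) ^ 2) +
      x * y * (1 - normFun x) ^ 2 / ((1 - y) ^ 2 * (1 - y * normFun x))) := by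
  have hu := four_s_mul_one_sub_normFun x
  have hw := sqrtOneSub_sq x
  have hs : ((4 * s : ℝ) : ℂ) ≠ 0 := by exact_mod_cast (by linarith [s_pos] : 4 * s ≠ 0)
  have hq : ((4 * s : ℝ) : ℂ) * ((q * s : ℝ) : ℂ) = (sqrtAtOne : ℂ) := by
    rw [← Complex.ofReal_mul, sqrtAtOne, q_div_r, div_eq_mul_inv, r_inv]
    congr 1
    ring
  have h1 : (sqrtOneSub x * ((sqrtAtOne : ℂ) - sqrtOneSub ((r⁻¹ ^ 2 : ℝ) * x)) +
        sqrtOneSub x ^ 3 * sqrtOneSub ((r⁻¹ ^ 2 : ℝ) * x) +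
        x * (r⁻¹ : ℝ) * sqrtOneSub x ^ 2) =
      (4 * s : ℝ) * (((q * s : ℝ) : ℂ) * sqrtOneSub x - x * (1 - normFun x)) := by
    linear_combination (-sqrtOneSub x) * hq + x * hu +
      sqrtOneSub x * sqrtOneSub ((r⁻¹ ^ 2 : ℝ) * x) * hw
  rw [h1, mul_div_mul_left _ _ hs, errorFun, genFun]
  have h2 : ((-2 * q * s ^ 2 : ℝ) : ℂ) = -((2 * s : ℝ) : ℂ) * ((q * s : ℝ) : ℂ) := by
    push_cast; ring
  simp only
  rw [h2]
  generalize ((q * s : ℝ) : ℂ) = b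
  generalize ((2 * s : ℝ) : ℂ) = a
  generalize sqrtOneSub x = w
  generalize normFun x = v at *
  field_simp
  ring

lemma norm_errorFun_le : ∃ K : ℝ, ∀ x y : ℂ, ‖x‖ ≤ 2 → ‖normFun x‖ < 1 → ‖y‖ < 1 →
    ‖errorFun (x, y)‖ ≤ K * (‖1 - x‖ * ((1 - ‖y‖) ^ 3)⁻¹) := by
  have hs := s_pos
  have hh := sqrtAtOne_pos
  have hr0 := r_inv_pos
  have hr1 := r_inv_lt_one
  refine ⟨2 * s * ((2 * sqrtAtOne⁻¹ + 6) / (4 * s) + 2 / s ^ 2), fun x y hx hv hy => ?_⟩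
  have hy0 : 0 < 1 - ‖y‖ := by linarith
  have hyn : 1 - ‖y‖ ≤ ‖1 - y‖ := by simpa using one_sub_norm_le (y := y) (v := 1) (by simp)
  have hvn : 1 - ‖y‖ ≤ ‖1 - y * normFun x‖ := one_sub_norm_le hv.le
  have hv0 : 1 - y * normFun x ≠ 0 := norm_pos_iff.1 (by linarith)
  rw [errorFun_eq (one_sub_ne_zero hy) hv0]
  have hu := four_s_mul_one_sub_normFun x
  have ht := norm_sqrtAtOne_sub_le x
  have hw2 := norm_sqrtOneSub_sq x
  have ht2 := norm_sqrtOneSub_sq ((r⁻¹ ^ 2 : ℝ) * x)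
  have hw3 : ‖sqrtOneSub x‖ ≤ 2 := by
    have := norm_sub_le 1 x
    rw [norm_one] at this
    nlinarith
  have ht3 : ‖sqrtOneSub ((r⁻¹ ^ 2 : ℝ) * x)‖ ≤ 2 := by
    have := norm_sub_le 1 ((r⁻¹ ^ 2 : ℝ) * x)
    rw [norm_one, norm_mul, Complex.norm_real, Real.norm_of_nonneg r_inv_sq_pos.le] at this
    nlinarith [r_inv_sq_lt_one, norm_nonneg x]
  rw [← hw2]
  set w := sqrtOneSub x
  set t := sqrtOneSub ((r⁻¹ ^ 2 : ℝ) * x)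
  have hA : ‖w * ((sqrtAtOne : ℂ) - t) + w ^ 3 * t + x * (r⁻¹ : ℝ) * w ^ 2‖ ≤
      (2 * sqrtAtOne⁻¹ + 6) * ‖w‖ ^ 2 := by
    refine (norm_add₃_le).trans ?_
    simp only [norm_mul, norm_pow, Complex.norm_real, Real.norm_of_nonneg hr0.le]
    have a1 : ‖w‖ * ‖(sqrtAtOne : ℂ) - t‖ ≤ 2 * (sqrtAtOne⁻¹ * ‖w‖ ^ 2) := by gcongr
    have a2 : ‖w‖ ^ 3 * ‖t‖ ≤ 2 * ‖w‖ ^ 2 * 2 := by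
      rw [pow_succ' _ 2]
      gcongr
    have a3 : ‖x‖ * r⁻¹ * ‖w‖ ^ 2 ≤ 2 * 1 * ‖w‖ ^ 2 := by gcongr
    linarith
  have hU : ‖1 - normFun x‖ ≤ ‖w‖ / s := by
    have h1 := congrArg norm hu
    rw [norm_mul, Complex.norm_real, Real.norm_of_nonneg (by positivity : 0 ≤ 4 * s)] at h1
    have h2 := norm_sub_le (w * t) ((r⁻¹ : ℝ) * w ^ 2)
    rw [← h1, norm_mul, norm_mul, norm_pow, Complex.norm_real, Real.norm_of_nonneg hr0.le] at h2
    have a1 : ‖w‖ * ‖t‖ ≤ ‖w‖ * 2 := by gcongr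
    have a2 : r⁻¹ * ‖w‖ ^ 2 ≤ 1 * (2 * ‖w‖) := by
      rw [sq]
      gcongr
    rw [le_div_iff₀ hs]
    linarith
  have hd : (1 - ‖y‖) ^ 3 ≤ (1 - ‖y‖) ^ 2 :=
    pow_le_pow_of_le_one hy0.le (by linarith [norm_nonneg y]) (by norm_num)
  have hT1 : ‖(w * ((sqrtAtOne : ℂ) - t) + w ^ 3 * t + x * (r⁻¹ : ℝ) * w ^ 2) /
      ((4 * s : ℝ) * (1 - y) ^ 2)‖ ≤
      (2 * sqrtAtOne⁻¹ + 6) * ‖w‖ ^ 2 / (4 * s * (1 - ‖y‖) ^ 3) := by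
    rw [norm_div, norm_mul, norm_pow, Complex.norm_real,
      Real.norm_of_nonneg (by positivity : 0 ≤ 4 * s)]
    have : (1 - ‖y‖) ^ 3 ≤ ‖1 - y‖ ^ 2 := hd.trans (by gcongr)
    gcongr
  have hT2 : ‖x * y * (1 - normFun x) ^ 2 / ((1 - y) ^ 2 * (1 - y * normFun x))‖ ≤
      2 * 1 * (‖w‖ / s) ^ 2 / ((1 - ‖y‖) ^ 2 * (1 - ‖y‖)) := by
    rw [norm_div, norm_mul, norm_mul, norm_mul, norm_pow, norm_pow]
    gcongr
  rw [norm_mul, norm_mul, norm_pow, Complex.norm_real,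
    Real.norm_of_nonneg (by positivity : 0 ≤ 2 * s)]
  have hy2 : ‖y‖ ^ 2 ≤ 1 := pow_le_one₀ (norm_nonneg _) hy.le
  calc _ ≤ 2 * s * 1 * ((2 * sqrtAtOne⁻¹ + 6) * ‖w‖ ^ 2 / (4 * s * (1 - ‖y‖) ^ 3) +
        2 * 1 * (‖w‖ / s) ^ 2 / ((1 - ‖y‖) ^ 2 * (1 - ‖y‖))) := by
        gcongr
        exact (norm_add_le _ _).trans (add_le_add hT1 hT2)
    _ = _ := by
        field_simp

lemma admissible_pi_div_three {ε : ℝ} (hε : 0 < ε) : Admissible ε (Real.pi / 3) :=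
  ⟨hε, by positivity, by linarith [Real.pi_pos]⟩

theorem isApprox_genFun : IsApprox genFun ((-2 * q * s ^ 2 : ℝ) : ℂ) (-1 / 2) 2 := by
  obtain ⟨ε, hε, hε1, hdom⟩ := exists_norm_normFun_lt_one
  obtain ⟨K, hK⟩ := norm_errorFun_le
  have hq := q_pos
  have hs := s_pos
  have hslit : ∀ x ∈ deltaDomain ε (Real.pi / 3), 1 - x ∈ Complex.slitPlane := fun x hx =>
    one_sub_mem_slitPlane_of_re hx.2.1 (re_le_of_mem_deltaDomain hx)
  have hbound : ∀ x y : ℂ, (x, y) ∈ rDomain ε (Real.pi / 3) →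
      ‖errorFun (x, y)‖ ≤ K * (‖1 - x‖ ^ (-(-1 : ℝ)) * (1 - ‖y‖) ^ (-3 : ℝ)) := by
    intro x y hxy
    have h1 := hK x y (hxy.1.1.trans (by linarith)) (hdom x hxy.1) hxy.2
    have h2 : ‖y‖ < 1 := hxy.2
    rwa [neg_neg, Real.rpow_one, Real.rpow_neg (by linarith), Real.rpow_ofNat]
  refine ⟨?_, -1, 3, fun y => ((-2 * q * s ^ 2 : ℝ) : ℂ) * y ^ 2, 2, 0,
    fun i y => if i = 1 then (2 * s : ℝ) * y ^ 2 / (1 - y) else 0, fun _ _ => 0, errorFun, ε,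
    Real.pi / 3, by norm_num, by norm_num, admissible_pi_div_three hε, ?_, ?_, ?_, ?_, ?_, ?_⟩
  · exact_mod_cast (by nlinarith [mul_pos hq (pow_pos hs 2)] : -2 * q * s ^ 2 < 0).ne
  · intro x y hxy
    have e1 : (1 - x) ^ (-((-1 / 2 : ℝ) : ℂ)) = sqrtOneSub x := by
      rw [sqrtOneSub]
      congr 1
      push_cast
      ring
    have e2 : (1 - y) ^ (-((2 : ℝ) : ℂ)) = ((1 - y) ^ 2)⁻¹ := by
      rw [Complex.cpow_neg, Complex.ofReal_ofNat, Complex.cpow_ofNat]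
    rw [e1, e2, errorFun]
    simp only [Finset.sum_range_succ, Finset.sum_range_zero]
    norm_num
  · refine ⟨1, Real.pi / 3, admissible_pi_div_three one_pos, ?_,
      ‖((-2 * q * s ^ 2 : ℝ) : ℂ)‖ * 3, fun y hy => ?_⟩
    · exact fun y _ => analyticAt_const.mul (analyticAt_id.pow 2)
    · have e : ((-2 * q * s ^ 2 : ℝ) : ℂ) * y ^ 2 - ((-2 * q * s ^ 2 : ℝ) : ℂ) =
          -(((-2 * q * s ^ 2 : ℝ) : ℂ) * (1 + y) * (1 - y)) := by ring
      rw [e, norm_neg, norm_mul, norm_mul]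
      gcongr
      have h1 := hy.1
      exact (norm_add_le _ _).trans (by rw [norm_one]; linarith)
  · intro i y hy
    by_cases hi : i = 1
    · simp only [hi, if_true]
      exact (analyticAt_const.mul (analyticAt_id.pow 2)).div
        (analyticAt_const.sub analyticAt_id) (one_sub_ne_zero hy)
    · simp only [hi, if_false]
      exact analyticAt_const
  · exact fun _ _ _ => analyticAt_const
  · exact fun z hz => analyticAt_errorFun (hslit _ hz.1) (hdom _ hz.1) hz.2
  · exact ⟨-1, 3, 0, by norm_num, le_rfl, ⟨K, hbound⟩, K, 1, one_pos,
      fun x y hxy _ => hbound x y hxy⟩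

theorem isAnalyticSum_genFun : IsAnalyticSum scaledCoeff genFun := by
  obtain ⟨ε, hε, hε1, hdom⟩ := exists_norm_normFun_lt_one
  refine ⟨⟨ε, Real.pi / 3, admissible_pi_div_three hε, fun z hz => ?_⟩,
    fun x y hx hy => hasSum_genFun hx hy⟩
  exact analyticAt_genFun (one_sub_mem_slitPlane_of_re hz.1.2.1 (re_le_of_mem_deltaDomain hz.1))
    (hdom _ hz.1) hz.2

end DissectionTrees

theorem mainTheorem4 :
    (∃ f : ℂ × ℂ → ℂ,
      DissectionTrees.IsAnalyticSum DissectionTrees.scaledCoeff f ∧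
      DissectionTrees.IsApprox f
        ((-2 * DissectionTrees.q * DissectionTrees.s ^ 2 : ℝ) : ℂ) (-1 / 2) 2) ∧
    (∀ p : ℝ, 0 < p → p < DissectionTrees.r ^ (1 / 2 : ℝ) →
      ∃ M : ℝ, 0 < M ∧ ∀ n k : ℕ, 2 ≤ n → 2 ≤ k →
        (DissectionTrees.treeCount n k : ℝ) ≤
          M * DissectionTrees.r ^ n * (n : ℝ) ^ (-3 / 2 : ℝ) * p ^ (-(k : ℤ))) ∧
    (∀ L : ℝ, 0 < L →
      ∃ M : ℝ, 0 < M ∧ ∃ k₀ : ℕ, ∀ n k : ℕ, 2 ≤ n → 2 ≤ k → k₀ ≤ k →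
        (k : ℝ) ≤ L * Real.log n →
        |(DissectionTrees.treeCount n k : ℝ) -
            DissectionTrees.q * DissectionTrees.s ^ 2 / √Real.pi *
              DissectionTrees.r ^ ((n : ℝ) - (k : ℝ) / 2) * (n : ℝ) ^ (-3 / 2 : ℝ) * (k : ℝ)| ≤
          M * DissectionTrees.r ^ ((n : ℝ) - (k : ℝ) / 2) * (n : ℝ) ^ (-3 / 2 : ℝ)) := by
  exact ⟨⟨DissectionTrees.genFun, DissectionTrees.isAnalyticSum_genFun,
    DissectionTrees.isApprox_genFun⟩, DissectionTrees.treeCount_le,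
    DissectionTrees.treeCount_asymp⟩
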